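/- **Theorem.** Let $n, k, r$ be integers with $n \ge 1$, $0 \le k \le n$ and $r \ge 2$. Let $\mathbb{C}[\mathbf{x}_n] = \mathbb{C}[x_1,\dots,x_n]$, ordered by the lexicographic monomial order with $x_1 > x_2 > \cdots > x_n$. Let $e_d(\mathbf{x}_n^r) = e_d(x_1^r,\dots,x_n^r)$ be the elementary symmetric polynomials in $x_1^r,\dots,x_n^r$, and let $$I_{n,k} = \langle x_1^{kr+1},\dots,x_n^{kr+1},\, e_n(\mathbf{x}_n^r), e_{n-1}(\mathbf{x}_n^r), \dots, e_{n-k+1}(\mathbf{x}_n^r)\rangle,$$ $$J_{n,k} = \langle x_1^{kr},\dots,x_n^{kr},\, e_n(\mathbf{x}_n^r), e_{n-1}(\mathbf{x}_n^r), \dots, e_{n-k+1}(\mathbf{x}_n^r)\rangle.$$ For a sequence $\gamma = (\gamma_1,\dots,\gamma_n)$ of nonnegative integers the *Demazure character* $\kappa_\gamma(\mathbf{x}_n)$ is the polynomial determined by the following recursion: $\kappa_\gamma = x_1^{\gamma_1}\cdots x_n^{\gamma_n}$ if $\gamma_1 \ge \cdots \ge \gamma_n$, and $$\kappa_\gamma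 = \frac{x_i\,\kappa_{\gamma'} - x_{i+1}\,(s_i\cdot\kappa_{\gamma'})}{x_i - x_{i+1}}$$ if $\gamma_i < \gamma_{i+1}$, where $\gamma'$ is $\gamma$ with its $i$-th and $(i+1)$-st parts interchanged and $s_i$ interchanges the variables $x_i$ and $x_{i+1}$. For $S = \{s_1 < \cdots < s_m\} \subseteq [n] = \{1,\dots,n\}$ the *skip composition* $\gamma(S) = (\gamma_1,\dots,\gamma_n)$ has $\gamma_i = s_j - j + 1$ if $i = s_j \in S$ and $\gamma_i = 0$ if $i \notin S$; let $\overline{\gamma(S)} = (\gamma_n,\dots,\gamma_1)$. For $f \in \mathbb{C}[\mathbf{x}_n]$ write $\overline{f(\mathbf{x}_n^r)} = f(x_n^r,\dots,x_1^r)$. 1. The variable powers $x_1^{kr+1},\dots,x_n^{kr+1}$ together with the polynomials $\overline{\kappa_{\overline{\gamma(S)}}(\mathbf{x}_n^r)}$ for $S \subseteq [n]$ with $|S| = n-k+1$ form a Gröbner basis of $I_{n,k}$. If $n > k > 0$, this Gröbner basis is reduced. 2. The variable powers $x_1^{kr},\dots,x_n^{kr}$ together with the polynomials $\overline{\kappa_{\overline{\gamma(S)}}(\mathbf{x}_n^r)}$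 for $S \subseteq [n-1]$ with $|S| = n-k+1$ form a Gröbner basis of $J_{n,k}$. If $n > k > 0$, this Gröbner basis is reduced. Here a Gröbner basis of an ideal $I$ is a finite set of nonzero elements of $I$ whose leading terms generate the ideal generated by the leading terms of all nonzero elements of $I$. It is reduced if all its leading coefficients are $1$ and the leading monomial of one element never divides a monomial appearing in a different element. -/

import Mathlib

noncomputable section

namespace SkipGroebner

open MvPolynomial

/-! ### Initial ideals and Gröbner bases -/

section Groebner

/-- The initial ideal: generated by the leading terms of the nonzero elements of `I`. -/
def initialIdeal {σ R : Type*} [CommRing R] (m : MonomialOrder σ)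
    (I : Ideal (MvPolynomial σ R)) : Ideal (MvPolynomial σ R) :=
  Ideal.span {t | ∃ f ∈ I, f ≠ 0 ∧ t = m.leadingTerm f}

/-- A finite set `B` of nonzero elements of `I` is a Gröbner basis of `I` if the leading terms of
its elements generate the initial ideal of `I`. -/
def IsGroebnerBasis {σ R : Type*} [CommRing R] (m : MonomialOrder σ)
    (B : Set (MvPolynomial σ R)) (I : Ideal (MvPolynomial σ R)) : Prop :=
  B.Finite ∧ (∀ g ∈ B, g ∈ I ∧ g ≠ 0) ∧
    initialIdeal m I = Ideal.span {t | ∃ g ∈ B, t = m.leadingTerm g}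

/-- A Gröbner basis is reduced if all leading coefficients are `1` and the leading monomial of an
element divides no monomial appearing in another element. (The monomial with exponent `c` divides
the monomial with exponent `d` exactly when `c ≤ d` componentwise.) -/
def IsReducedGroebnerBasis {σ R : Type*} [CommRing R] (m : MonomialOrder σ)
    (B : Set (MvPolynomial σ R)) (I : Ideal (MvPolynomial σ R)) : Prop :=
  IsGroebnerBasis m B I ∧ (∀ g ∈ B, m.leadingCoeff g = 1) ∧
    ∀ g ∈ B, ∀ h ∈ B, g ≠ h → ∀ d ∈ h.support, ¬ m.degree g ≤ d

end Groebner

/-! ### Demazure characters -/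

section Demazure

variable {n : ℕ}

/-- `s f`, the polynomial `f` with the variables `x_i` and `x_j` interchanged. -/
abbrev swapVars (i j : Fin n) : MvPolynomial (Fin n) ℂ →ₐ[ℂ] MvPolynomial (Fin n) ℂ :=
  rename (Equiv.swap i j)

theorem X_sub_X_dvd (i j : Fin n) (f : MvPolynomial (Fin n) ℂ) :
    (X i - X j : MvPolynomial (Fin n) ℂ) ∣ X i * f - X j * swapVars i j f := by
  have key : (X i - X j : MvPolynomial (Fin n) ℂ) ∣ f - swapVars i j f := by
    rw [← Ideal.mem_span_singleton, ← Ideal.Quotient.mk_eq_mk_iff_sub_mem]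
    set I : Ideal (MvPolynomial (Fin n) ℂ) := Ideal.span {X i - X j}
    have hij : Ideal.Quotient.mkₐ ℂ I (X i) = Ideal.Quotient.mkₐ ℂ I (X j) :=
      (Ideal.Quotient.mk_eq_mk_iff_sub_mem _ _).2 (Ideal.mem_span_singleton_self _)
    have h : Ideal.Quotient.mkₐ ℂ I = (Ideal.Quotient.mkₐ ℂ I).comp (swapVars i j) := by
      apply MvPolynomial.algHom_ext
      intro a
      simp only [AlgHom.comp_apply, rename_X]
      by_cases h1 : a = i
      · subst h1; rw [Equiv.swap_apply_left, hij]
      by_cases h2 : a = j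
      · subst h2; rw [Equiv.swap_apply_right, hij]
      rw [Equiv.swap_apply_of_ne_of_ne h1 h2]
    exact congrArg (fun φ => φ f) h
  have e : X i * f - X j * swapVars i j f
      = (X i - X j) * f + X j * (f - swapVars i j f) := by ring
  rw [e]
  exact dvd_add (dvd_mul_right _ _) (key.mul_left _)

/-- The quotient `(x_i f - x_j (s f)) / (x_i - x_j)`, a polynomial; it is determined by
`demazureOp_spec` when `i ≠ j`. -/
def demazureOp (i j : Fin n) (f : MvPolynomial (Fin n) ℂ) : MvPolynomial (Fin n) ℂ :=
  (X_sub_X_dvd i j f).choose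

theorem demazureOp_spec (i j : Fin n) (f : MvPolynomial (Fin n) ℂ) :
    (X i - X j) * demazureOp i j f = X i * f - X j * swapVars i j f :=
  (X_sub_X_dvd i j f).choose_spec.symm

/-- `i` and `j` are consecutive positions at which the composition `γ` increases. -/
def IsAscent (γ : Fin n → ℕ) (i j : Fin n) : Prop :=
  (i : ℕ) + 1 = j ∧ γ i < γ j

/-- Interchange the parts in positions `i` and `j`. -/
def swapParts (γ : Fin n → ℕ) (i j : Fin n) : Fin n → ℕ :=
  γ ∘ Equiv.swap i j

/-- The termination measure for the recursion below. -/
def weight (γ : Fin n → ℕ) : ℕ := ∑ a : Fin n, (a : ℕ) * γ a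

theorem weight_swapParts_lt (γ : Fin n → ℕ) (i j : Fin n) (h : IsAscent γ i j) :
    weight (swapParts γ i j) < weight γ := by
  obtain ⟨h1, h2⟩ := h
  have hne : i ≠ j := by rintro rfl; omega
  have hj : j ∈ Finset.univ.erase i := by simp [hne.symm]
  unfold weight
  rw [← Finset.add_sum_erase _ _ (Finset.mem_univ i), ← Finset.add_sum_erase _ _ hj,
    ← Finset.add_sum_erase _ (fun a : Fin n => (a : ℕ) * γ a) (Finset.mem_univ i),
    ← Finset.add_sum_erase _ (fun a : Fin n => (a : ℕ) * γ a) hj]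
  have e : ∑ a ∈ (Finset.univ.erase i).erase j, (a : ℕ) * swapParts γ i j a
      = ∑ a ∈ (Finset.univ.erase i).erase j, (a : ℕ) * γ a := by
    apply Finset.sum_congr rfl
    intro a ha
    simp only [Finset.mem_erase, Finset.mem_univ, and_true] at ha
    simp [swapParts, Equiv.swap_apply_of_ne_of_ne ha.2 ha.1]
  rw [e]
  simp only [swapParts, Function.comp, Equiv.swap_apply_left, Equiv.swap_apply_right, ← h1]
  nlinarith

open scoped Classical in
/-- The Demazure character `κ_γ`. If `γ` has an ascent, one is chosen and the recursion
is applied there; otherwise `γ` is weakly decreasing and `κ_γ = x^γ`. The choice is immaterial: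
see `demazureChar_of_isAscent` below. -/
def demazureChar (γ : Fin n → ℕ) : MvPolynomial (Fin n) ℂ :=
  if h : ∃ p : Fin n × Fin n, IsAscent γ p.1 p.2 then
    demazureOp h.choose.1 h.choose.2
      (demazureChar (swapParts γ h.choose.1 h.choose.2))
  else ∏ i, X i ^ γ i
termination_by weight γ
decreasing_by exact weight_swapParts_lt _ _ _ h.choose_spec

/-- If `γ` is weakly decreasing then `κ_γ = x^γ`. -/
theorem demazureChar_of_antitone (γ : Fin n → ℕ) (h : Antitone γ) :
    demazureChar γ = ∏ i, X i ^ γ i := by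
  rw [demazureChar.eq_def, dif_neg]
  rintro ⟨p, hp, hlt⟩
  have : p.1 ≤ p.2 := by rw [Fin.le_def]; omega
  exact absurd (h this) (by omega)

theorem X_sub_X_ne_zero {i j : Fin n} (h : i ≠ j) :
    (X i - X j : MvPolynomial (Fin n) ℂ) ≠ 0 :=
  sub_ne_zero.2 fun e => h (X_injective e)

theorem swapVars_spec (a b i j : Fin n) (f : MvPolynomial (Fin n) ℂ) :
    (X (Equiv.swap a b i) - X (Equiv.swap a b j)) * swapVars a b (demazureOp i j f)
      = X (Equiv.swap a b i) * swapVars a b f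
        - X (Equiv.swap a b j) * swapVars a b (swapVars i j f) := by
  have := congrArg (swapVars a b) (demazureOp_spec i j f)
  simpa [map_mul, map_sub, rename_X] using this

theorem demazureOp_comm {i j k l : Fin n} (hij : i ≠ j) (hkl : k ≠ l) (hik : i ≠ k) (hil : i ≠ l)
    (hjk : j ≠ k) (hjl : j ≠ l) (f : MvPolynomial (Fin n) ℂ) :
    demazureOp i j (demazureOp k l f) = demazureOp k l (demazureOp i j f) := by
  apply mul_left_cancel₀ (mul_ne_zero (X_sub_X_ne_zero hij) (X_sub_X_ne_zero hkl))
  have hc : swapVars i j (swapVars k l f) = swapVars k l (swapVars i j f) := by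
    simp only [swapVars, rename_rename]
    congr 2
    funext a
    have : (Equiv.swap i j) * (Equiv.swap k l) = (Equiv.swap k l) * (Equiv.swap i j) := by
      apply Equiv.Perm.Disjoint.commute
      intro a
      by_cases h1 : a = i
      · right; subst h1; exact Equiv.swap_apply_of_ne_of_ne hik hil
      by_cases h2 : a = j
      · right; subst h2; exact Equiv.swap_apply_of_ne_of_ne hjk hjl
      left; exact Equiv.swap_apply_of_ne_of_ne h1 h2
    exact congrArg (fun σ : Equiv.Perm (Fin n) => σ a) this
  have a1 := demazureOp_spec i j (demazureOp k l f)
  have a2 := demazureOp_spec k l f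
  have a3 := swapVars_spec i j k l f
  have b1 := demazureOp_spec k l (demazureOp i j f)
  have b2 := demazureOp_spec i j f
  have b3 := swapVars_spec k l i j f
  rw [Equiv.swap_apply_of_ne_of_ne hik.symm hjk.symm,
    Equiv.swap_apply_of_ne_of_ne hil.symm hjl.symm] at a3
  rw [Equiv.swap_apply_of_ne_of_ne hik hil, Equiv.swap_apply_of_ne_of_ne hjk hjl] at b3
  rw [hc] at a3
  linear_combination (X k - X l) * a1 + X i * a2 - X j * a3
    - (X i - X j) * b1 - X k * b2 + X l * b3

theorem demazureOp_braid {i j k : Fin n} (hij : i ≠ j) (hjk : j ≠ k) (hik : i ≠ k)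
    (f : MvPolynomial (Fin n) ℂ) :
    demazureOp i j (demazureOp j k (demazureOp i j f))
      = demazureOp j k (demazureOp i j (demazureOp j k f)) := by
  have hb : swapVars i j (swapVars j k (swapVars i j f))
      = swapVars j k (swapVars i j (swapVars j k f)) := by
    simp only [swapVars, rename_rename]
    congr 2
    funext a
    simp only [Function.comp]
    have h1 := Equiv.swap_mul_swap_mul_swap hij hik
    grind
  have inv : ∀ (a b : Fin n), a ≠ b → ∀ g : MvPolynomial (Fin n) ℂ,
      swapVars a b (demazureOp a b g) = demazureOp a b g := by
    intro a b hab g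
    apply mul_left_cancel₀ (X_sub_X_ne_zero hab)
    have h1 := swapVars_spec a b a b g
    have h2 := demazureOp_spec a b g
    have h3 : swapVars a b (swapVars a b g) = g := by
      have : (Equiv.swap a b : Fin n → Fin n) ∘ Equiv.swap a b = id := by
        funext c; simp
      rw [swapVars, rename_rename, this, rename_id_apply]
    rw [Equiv.swap_apply_left, Equiv.swap_apply_right, h3] at h1
    linear_combination -h1 - h2
  apply mul_left_cancel₀ (mul_ne_zero (mul_ne_zero (X_sub_X_ne_zero hij) (X_sub_X_ne_zero hjk))
    (X_sub_X_ne_zero hik))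
  have sik : Equiv.swap i j k = k := Equiv.swap_apply_of_ne_of_ne hik.symm hjk.symm
  have ski : Equiv.swap j k i = i := Equiv.swap_apply_of_ne_of_ne hij hik
  have si : Equiv.swap i j i = j := Equiv.swap_apply_left _ _
  have sj : Equiv.swap i j j = i := Equiv.swap_apply_right _ _
  have tj : Equiv.swap j k j = k := Equiv.swap_apply_left _ _
  have tk : Equiv.swap j k k = j := Equiv.swap_apply_right _ _
  -- the left side
  have p1 := demazureOp_spec i j (demazureOp j k (demazureOp i j f))
  have p2 := demazureOp_spec j k (demazureOp i j f)
  have p3 := swapVars_spec i j j k (demazureOp i j f)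
  have p4 := demazureOp_spec i j f
  have p5 := swapVars_spec j k i j f
  have p6 := congrArg (swapVars i j) p5
  -- the right side
  have q1 := demazureOp_spec j k (demazureOp i j (demazureOp j k f))
  have q2 := demazureOp_spec i j (demazureOp j k f)
  have q3 := swapVars_spec j k i j (demazureOp j k f)
  have q4 := demazureOp_spec j k f
  have q5 := swapVars_spec i j j k f
  have q6 := congrArg (swapVars j k) q5
  rw [inv i j hij] at p3
  rw [inv j k hjk] at q3
  simp only [map_mul, map_sub, rename_X, sik, ski, si, sj, tj, tk] at p3 p5 p6 q3 q5 q6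
  rw [hb] at p6
  linear_combination (X j - X k) * (X i - X k) * p1 + X i * (X i - X k) * p2
    - X j * (X j - X k) * p3 + X i * X j * p4 - X i * X k * p5 + X j * X k * p6
    - ((X i - X j) * (X i - X k) * q1 + X j * (X i - X k) * q2 - X k * (X i - X j) * q3
      + X i ^ 2 * q4 - X j ^ 2 * q5 + X k ^ 2 * q6)

/-- The recursion for Demazure characters: it holds at every ascent of `γ`. -/
theorem demazureChar_of_isAscent (γ : Fin n → ℕ) (i j : Fin n) (h : IsAscent γ i j) :
    demazureChar γ = demazureOp i j (demazureChar (swapParts γ i j)) := by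
  induction hN : weight γ using Nat.strong_induction_on generalizing γ i j with
  | _ N ih =>
  subst hN
  replace ih : ∀ δ : Fin n → ℕ, weight δ < weight γ → ∀ i j, IsAscent δ i j →
      demazureChar δ = demazureOp i j (demazureChar (swapParts δ i j)) :=
    fun δ hδ i j hij => ih _ hδ δ i j hij rfl
  -- three consecutive increasing parts
  have chain : ∀ a b c : Fin n, IsAscent γ a b → IsAscent γ b c →
      demazureOp a b (demazureChar (swapParts γ a b))
        = demazureOp b c (demazureChar (swapParts γ b c)) := by
    intro a b c hab hbc
    have w1 := weight_swapParts_lt γ a b hab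
    have w2 := weight_swapParts_lt γ b c hbc
    obtain ⟨e1, l1⟩ := hab
    obtain ⟨e2, l2⟩ := hbc
    have nab : a ≠ b := by rintro rfl; omega
    have nbc : b ≠ c := by rintro rfl; omega
    have nac : a ≠ c := by rintro rfl; omega
    have u1 : IsAscent (swapParts γ a b) b c := by
      refine ⟨e2, ?_⟩
      simp only [swapParts, Function.comp, Equiv.swap_apply_right,
        Equiv.swap_apply_of_ne_of_ne nac.symm nbc.symm]
      omega
    have w3 := weight_swapParts_lt _ _ _ u1
    have u2 : IsAscent (swapParts (swapParts γ a b) b c) a b := by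
      refine ⟨e1, ?_⟩
      simp only [swapParts, Function.comp, Equiv.swap_apply_left,
        Equiv.swap_apply_of_ne_of_ne nac.symm nbc.symm, Equiv.swap_apply_of_ne_of_ne nab nac]
      omega
    have u3 : IsAscent (swapParts γ b c) a b := by
      refine ⟨e1, ?_⟩
      simp only [swapParts, Function.comp, Equiv.swap_apply_left,
        Equiv.swap_apply_of_ne_of_ne nab nac]
      omega
    have w4 := weight_swapParts_lt _ _ _ u3
    have u4 : IsAscent (swapParts (swapParts γ b c) a b) b c := by
      refine ⟨e2, ?_⟩
      simp only [swapParts, Function.comp, Equiv.swap_apply_right,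
        Equiv.swap_apply_of_ne_of_ne nac.symm nbc.symm, Equiv.swap_apply_of_ne_of_ne nab nac]
      omega
    rw [ih _ w1 _ _ u1, ih _ (w3.trans w1) _ _ u2, ih _ w2 _ _ u3, ih _ (w4.trans w2) _ _ u4,
      demazureOp_braid nab nbc nac]
    congr 4
    funext d
    simp only [swapParts, Function.comp]
    congr 1
    grind
  have hex : ∃ p : Fin n × Fin n, IsAscent γ p.1 p.2 := ⟨(i, j), h⟩
  obtain ⟨a, b, hab, hγ⟩ : ∃ a b, IsAscent γ a b ∧
      demazureChar γ = demazureOp a b (demazureChar (swapParts γ a b)) := by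
    refine ⟨hex.choose.1, hex.choose.2, hex.choose_spec, ?_⟩
    conv_lhs => rw [demazureChar.eq_def, dif_pos hex]
  rw [hγ]
  by_cases hai : a = i
  · have : b = j := by
      subst hai; apply Fin.ext; have := hab.1; have := h.1; omega
    rw [hai, this]
  by_cases hbi : b = i
  · subst hbi; exact chain _ _ _ hab h
  by_cases hja : j = a
  · subst hja; exact (chain _ _ _ h hab).symm
  have hjb : j ≠ b := by
    rintro rfl; apply hai; apply Fin.ext; have := hab.1; have := h.1; omega
  have nab : a ≠ b := by rintro rfl; have := hab.1; omega
  have nij : i ≠ j := by rintro rfl; have := h.1; omega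
  have u1 : IsAscent (swapParts γ a b) i j := by
    refine ⟨h.1, ?_⟩
    simp only [swapParts, Function.comp, Equiv.swap_apply_of_ne_of_ne (Ne.symm hai) (Ne.symm hbi),
      Equiv.swap_apply_of_ne_of_ne hja hjb]
    exact h.2
  have u2 : IsAscent (swapParts γ i j) a b := by
    refine ⟨hab.1, ?_⟩
    simp only [swapParts, Function.comp, Equiv.swap_apply_of_ne_of_ne hai (Ne.symm hja),
      Equiv.swap_apply_of_ne_of_ne hbi hjb.symm]
    exact hab.2
  rw [ih _ (weight_swapParts_lt _ _ _ hab) _ _ u1, ih _ (weight_swapParts_lt _ _ _ h) _ _ u2,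
    demazureOp_comm nab nij hai (Ne.symm hja) hbi hjb.symm]
  congr 3
  funext d
  simp only [swapParts, Function.comp]
  congr 1
  grind

end Demazure

/-! ### Skip compositions, the ideals, and the bases -/

/-- The skip composition `γ(S)` of `S ⊆ [n]`: if `i = s_j` is the `j`-th smallest element of `S`,
its `i`-th part is `s_j - j + 1`, and it is `0` if `i ∉ S`. The element `i : Fin n` stands for
`i + 1 ∈ [n]`, and `j - 1` is the number of elements of `S` smaller than it. -/
def skipComposition {n : ℕ} (S : Finset (Fin n)) (i : Fin n) : ℕ :=
  if i ∈ S then (i : ℕ) + 1 - (S.filter (· < i)).card else 0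

/-- The polynomial `f(x_n^r, …, x_1^r)`. -/
def reversePow {n : ℕ} (r : ℕ) (f : MvPolynomial (Fin n) ℂ) : MvPolynomial (Fin n) ℂ :=
  aeval (fun i => (X i.rev : MvPolynomial (Fin n) ℂ) ^ r) f

/-- The reversed Demazure character in `x^r` attached to the reverse of `γ(S)`. -/
def skipDemazure {n : ℕ} (r : ℕ) (S : Finset (Fin n)) : MvPolynomial (Fin n) ℂ :=
  reversePow r (demazureChar (fun i => skipComposition S i.rev))

/-- `e_d(x_1^r, …, x_n^r)`. -/
def esymmPow (n r d : ℕ) : MvPolynomial (Fin n) ℂ :=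
  aeval (fun i => (X i : MvPolynomial (Fin n) ℂ) ^ r) (esymm (Fin n) ℂ d)

/-- The ideal `I_{n,k}`. -/
def idealI (n k r : ℕ) : Ideal (MvPolynomial (Fin n) ℂ) :=
  Ideal.span ({f | ∃ i, f = X i ^ (k * r + 1)} ∪
    {f | ∃ d, n - k + 1 ≤ d ∧ d ≤ n ∧ f = esymmPow n r d})

/-- The ideal `J_{n,k}`. -/
def idealJ (n k r : ℕ) : Ideal (MvPolynomial (Fin n) ℂ) :=
  Ideal.span ({f | ∃ i, f = X i ^ (k * r)} ∪
    {f | ∃ d, n - k + 1 ≤ d ∧ d ≤ n ∧ f = esymmPow n r d})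

/-- The proposed Gröbner basis of `I_{n,k}`; here `S ⊆ [n]`. -/
def basisI (n k r : ℕ) : Set (MvPolynomial (Fin n) ℂ) :=
  {f | ∃ i, f = X i ^ (k * r + 1)} ∪
    {f | ∃ S : Finset (Fin n), S.card = n - k + 1 ∧ f = skipDemazure r S}

/-- The proposed Gröbner basis of `J_{n,k}`; here `S ⊆ [n-1]`. -/
def basisJ (n k r : ℕ) : Set (MvPolynomial (Fin n) ℂ) :=
  {f | ∃ i, f = X i ^ (k * r)} ∪
    {f | ∃ S : Finset (Fin n), (∀ i ∈ S, (i : ℕ) + 1 ≤ n - 1) ∧ S.card = n - k + 1 ∧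
      f = skipDemazure r S}

end SkipGroebner

end

/-!
For `δ` with weakly decreasing nonzero parts, such as the reverse of a skip composition, the
Demazure character `κ_δ` is a flagged Jacobi–Trudi determinant. Expanding the complete homogeneous
entries through `∏ (1 - x_i t)` puts it in the ideal of the high elementary symmetric polynomials,
and the support of `κ_δ` shows that the lexicographically leading exponent of the basis element
attached to `S` is `r γ(S)`.

It remains to see that every leading exponent of the ideal is bounded below by one of the basis.
Choose `k` nonzero numbers, let `V` consist of their `r`-th roots, together with `0` when the
variable powers are `x_i ^ (k r + 1)`, and take all points with coordinates in `V` whose `r`-th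
powers exhaust the `k` numbers. The ideal is contained in the ideal of top forms of the polynomials
vanishing at these points. Interpolation in one variable at a time shows that a vanishing polynomial
is zero as soon as no leading exponent of the basis divides one of its monomials. By division, the
same obstruction passes from vanishing polynomials to their top forms.
-/

noncomputable section

namespace SkipGroebner

open MvPolynomial

/-! ### Demazure operators and exponents -/

section Demazure

variable {n : ℕ} {i j : Fin n}

theorem demazureOp_eq_of_spec (h : i ≠ j) {f g : MvPolynomial (Fin n) ℂ}
    (hg : (X i - X j) * g = X i * f - X j * swapVars i j f) : demazureOp i j f = g :=
  mul_left_cancel₀ (X_sub_X_ne_zero h) ((demazureOp_spec i j f).trans hg.symm)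

theorem demazureOp_sum (h : i ≠ j) {ι : Type*} (s : Finset ι)
    (c f : ι → MvPolynomial (Fin n) ℂ) (hc : ∀ a ∈ s, swapVars i j (c a) = c a) :
    demazureOp i j (∑ a ∈ s, c a * f a) = ∑ a ∈ s, c a * demazureOp i j (f a) := by
  apply demazureOp_eq_of_spec h
  simp only [Finset.mul_sum, map_sum, map_mul, ← Finset.sum_sub_distrib]
  refine Finset.sum_congr rfl fun a ha => ?_
  rw [hc a ha]
  linear_combination c a * demazureOp_spec i j (f a)

theorem swapVars_swapVars (i j : Fin n) (f : MvPolynomial (Fin n) ℂ) :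
    swapVars i j (swapVars i j f) = f := by
  rw [swapVars, rename_rename, ← Equiv.coe_trans, Equiv.swap_swap, Equiv.coe_refl, rename_id_apply]

theorem swapVars_demazureOp (h : i ≠ j) (f : MvPolynomial (Fin n) ℂ) :
    swapVars i j (demazureOp i j f) = demazureOp i j f := by
  refine (demazureOp_eq_of_spec h ?_).symm
  have hswap := swapVars_spec i j i j f
  rw [Equiv.swap_apply_left, Equiv.swap_apply_right, swapVars_swapVars] at hswap
  linear_combination -hswap

theorem mapDomain_swap_apply (d : Fin n →₀ ℕ) (p : Fin n) :
    d.mapDomain (Equiv.swap i j) p = d (Equiv.swap i j p) := by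
  rw [Finsupp.mapDomain_equiv_apply, Equiv.symm_swap]

theorem coeff_mapDomain_swap_swapVars (d : Fin n →₀ ℕ) (f : MvPolynomial (Fin n) ℂ) :
    coeff (d.mapDomain (Equiv.swap i j)) (swapVars i j f) = coeff d f :=
  coeff_rename_mapDomain _ (Equiv.injective _) f d

theorem coeff_mapDomain_swap_demazureOp (h : i ≠ j) (d : Fin n →₀ ℕ)
    (f : MvPolynomial (Fin n) ℂ) :
    coeff (d.mapDomain (Equiv.swap i j)) (demazureOp i j f) = coeff d (demazureOp i j f) := by
  conv_lhs => rw [← swapVars_demazureOp h]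
  exact coeff_mapDomain_swap_swapVars d _

theorem coeff_demazureOp_of_apply_right_eq_zero (h : i ≠ j) (f : MvPolynomial (Fin n) ℂ)
    {d : Fin n →₀ ℕ} (hd : d j = 0) : coeff d (demazureOp i j f) = coeff d f := by
  have hspec := congrArg (coeff (Finsupp.single i 1 + d)) (demazureOp_spec i j f)
  have hj : ∀ g : MvPolynomial (Fin n) ℂ, coeff (Finsupp.single i 1 + d) (X j * g) = 0 := by
    intro g
    rw [coeff_X_mul', if_neg]
    simp [h, hd]
  simpa only [sub_mul, coeff_sub, coeff_X_mul, hj, sub_zero] using hspec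

theorem coeff_demazureOp_of_apply_left_eq_zero (h : i ≠ j) (f : MvPolynomial (Fin n) ℂ)
    {d : Fin n →₀ ℕ} (hd : d i = 0) :
    coeff d (demazureOp i j f) = coeff (d.mapDomain (Equiv.swap i j)) f := by
  rw [← coeff_mapDomain_swap_demazureOp h, coeff_demazureOp_of_apply_right_eq_zero h]
  rw [mapDomain_swap_apply, Equiv.swap_apply_right, hd]

theorem coeff_single_add_demazureOp (f : MvPolynomial (Fin n) ℂ) (c : Fin n →₀ ℕ) :
    coeff (Finsupp.single j 1 + c) (demazureOp i j f)
      = coeff (Finsupp.single i 1 + c) (demazureOp i j f) + coeff (Finsupp.single j 1 + c) f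
        - coeff (Finsupp.single j 1 + c.mapDomain (Equiv.swap i j)) f := by
  have hspec := congrArg (coeff (Finsupp.single i 1 + (Finsupp.single j 1 + c)))
    (demazureOp_spec i j f)
  have hswap : coeff (Finsupp.single i 1 + c) (swapVars i j f)
      = coeff (Finsupp.single j 1 + c.mapDomain (Equiv.swap i j)) f := by
    conv_rhs => rw [← coeff_mapDomain_swap_swapVars (i := i) (j := j)]
    rw [Finsupp.mapDomain_add, Finsupp.mapDomain_single, Equiv.swap_apply_right,
      ← Finsupp.mapDomain_comp, ← Equiv.coe_trans, Equiv.swap_swap, Equiv.coe_refl,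
      Finsupp.mapDomain_id]
  simp only [sub_mul, coeff_sub, coeff_X_mul] at hspec
  simp only [add_left_comm (Finsupp.single i 1) (Finsupp.single j 1), coeff_X_mul, hswap] at hspec
  linear_combination hspec

theorem exists_mem_support_of_mem_support_demazureOp_left (h : i ≠ j)
    {f : MvPolynomial (Fin n) ℂ} {d : Fin n →₀ ℕ} (hd : d ∈ (demazureOp i j f).support) :
    ∃ a ∈ f.support, (∀ p, p ≠ i → p ≠ j → d p = a p) ∧ d i + d j = a i + a j ∧
      d i ≤ max (a i) (a j) := by
  induction hdj : d j generalizing d with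
  | zero =>
    rw [mem_support_iff, coeff_demazureOp_of_apply_right_eq_zero h f hdj] at hd
    exact ⟨d, mem_support_iff.2 hd, by simp [hdj]⟩
  | succ s ih =>
    obtain ⟨c, rfl⟩ : ∃ c, d = Finsupp.single j 1 + c :=
      exists_add_of_le (Finsupp.single_le_iff.2 (by omega))
    have hcases : Finsupp.single i 1 + c ∈ (demazureOp i j f).support ∨
        Finsupp.single j 1 + c ∈ f.support ∨
        Finsupp.single j 1 + c.mapDomain (Equiv.swap i j) ∈ f.support := by
      rw [mem_support_iff, coeff_single_add_demazureOp] at hd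
      simp only [mem_support_iff]
      by_contra! hzero
      simp [hzero] at hd
    have hij : (Finsupp.single i 1 : Fin n →₀ ℕ) j = 0 := Finsupp.single_eq_of_ne h.symm
    have hji : (Finsupp.single j 1 : Fin n →₀ ℕ) i = 0 := Finsupp.single_eq_of_ne h
    have hoff : ∀ k p, p ≠ k → (Finsupp.single k 1 : Fin n →₀ ℕ) p = 0 := fun k p hp =>
      Finsupp.single_eq_of_ne hp
    simp only [Finsupp.add_apply, Finsupp.single_eq_same, hji, zero_add] at hdj ⊢
    rcases hcases with hmem | hmem | hmem
    · obtain ⟨a, ha, haoff, hsum, hle⟩ :=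
        ih hmem (by rw [Finsupp.add_apply, hij]; omega)
      simp only [Finsupp.add_apply, Finsupp.single_eq_same] at haoff hsum hle
      refine ⟨a, ha, fun p hpi hpj => ?_, by omega, by omega⟩
      rw [← haoff p hpi hpj, hoff i p hpi, hoff j p hpj]
    · refine ⟨_, hmem, fun p _ _ => rfl, ?_, ?_⟩ <;>
        simp only [Finsupp.add_apply, Finsupp.single_eq_same, hji, zero_add]
      · omega
      · exact le_max_left _ _
    · refine ⟨_, hmem, fun p hpi hpj => ?_, ?_, ?_⟩ <;>
        simp only [Finsupp.add_apply, mapDomain_swap_apply, Equiv.swap_apply_left,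
          Equiv.swap_apply_right, Finsupp.single_eq_same, hji, zero_add]
      · rw [Equiv.swap_apply_of_ne_of_ne hpi hpj]
      · omega
      · omega

theorem exists_mem_support_of_mem_support_demazureOp (h : i ≠ j)
    {f : MvPolynomial (Fin n) ℂ} {d : Fin n →₀ ℕ} (hd : d ∈ (demazureOp i j f).support) :
    ∃ a ∈ f.support, (∀ p, p ≠ i → p ≠ j → d p = a p) ∧ d i + d j = a i + a j ∧
      max (d i) (d j) ≤ max (a i) (a j) := by
  rcases le_total (d j) (d i) with hle | hle
  · rw [max_eq_left hle]
    exact exists_mem_support_of_mem_support_demazureOp_left h hd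
  · rw [max_eq_right hle, add_comm (d i)]
    rw [mem_support_iff, ← coeff_mapDomain_swap_demazureOp h, ← mem_support_iff] at hd
    obtain ⟨a, ha, hoff, hsum, hmax⟩ := exists_mem_support_of_mem_support_demazureOp_left h hd
    simp only [mapDomain_swap_apply, Equiv.swap_apply_left, Equiv.swap_apply_right]
      at hoff hsum hmax
    exact ⟨a, ha, fun p hi hj => by rw [← hoff p hi hj, Equiv.swap_apply_of_ne_of_ne hi hj],
      hsum, hmax⟩

end Demazure

/-! ### Supports of Demazure characters -/

/-- The nonzero parts of `γ` weakly decrease. Reversed skip compositions have this property, and it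
is inherited along the recursion for Demazure characters. -/
def NonzeroAntitone {ι : Type*} [Preorder ι] (γ : ι → ℕ) : Prop :=
  ∀ ⦃p q⦄, p < q → γ p ≠ 0 → γ q ≤ γ p

section DemazureChar

variable {n : ℕ} {γ : Fin n → ℕ} {i j : Fin n}

theorem IsAscent.lt (h : IsAscent γ i j) : i < j :=
  Fin.lt_def.2 (by have := h.1; omega)

theorem IsAscent.lt_iff_le (h : IsAscent γ i j) {p : Fin n} : i < p ↔ j ≤ p := by
  rw [Fin.lt_def, Fin.le_def, ← h.1, Nat.succ_le_iff]

theorem NonzeroAntitone.eq_zero_of_isAscent (hγ : NonzeroAntitone γ) (h : IsAscent γ i j) :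
    γ i = 0 :=
  of_not_not fun h0 => (hγ h.lt h0).not_gt h.2

theorem swapParts_apply_left (γ : Fin n → ℕ) (i j : Fin n) : swapParts γ i j i = γ j := by
  rw [swapParts, Function.comp_apply, Equiv.swap_apply_left]

theorem swapParts_apply_right (γ : Fin n → ℕ) (i j : Fin n) : swapParts γ i j j = γ i := by
  rw [swapParts, Function.comp_apply, Equiv.swap_apply_right]

theorem swapParts_apply_of_ne (γ : Fin n → ℕ) {p : Fin n} (hi : p ≠ i) (hj : p ≠ j) :
    swapParts γ i j p = γ p := by
  rw [swapParts, Function.comp_apply, Equiv.swap_apply_of_ne_of_ne hi hj]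

theorem IsAscent.swap_lt_swap (h : IsAscent γ i j) {p q : Fin n} (hpq : p < q)
    (hne : p = i → q ≠ j) : Equiv.swap i j p < Equiv.swap i j q := by
  have hij := h.1
  simp only [Equiv.swap_apply_def, Fin.lt_def, Fin.ext_iff, ne_eq] at *
  split_ifs <;> omega

theorem NonzeroAntitone.swapParts_of_isAscent (hγ : NonzeroAntitone γ) (h : IsAscent γ i j) :
    NonzeroAntitone (swapParts γ i j) := by
  intro p q hpq hp
  by_cases hij : p = i ∧ q = j
  · rw [hij.1, hij.2, swapParts_apply_left, swapParts_apply_right]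
    exact h.2.le
  · exact hγ (h.swap_lt_swap hpq (not_and.1 hij)) hp

@[elab_as_elim]
theorem NonzeroAntitone.induction {P : (γ : Fin n → ℕ) → NonzeroAntitone γ → Prop}
    (antitone : ∀ γ hγ, Antitone γ → P γ hγ)
    (ascent : ∀ γ hγ i j, ∀ h : IsAscent γ i j,
      P (swapParts γ i j) (hγ.swapParts_of_isAscent h) → P γ hγ)
    (γ : Fin n → ℕ) (hγ : NonzeroAntitone γ) : P γ hγ := by
  induction hN : weight γ using Nat.strong_induction_on generalizing γ with
  | _ N ih =>
  subst hN
  by_cases hex : ∃ i j, IsAscent γ i j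
  · obtain ⟨i, j, h⟩ := hex
    exact ascent γ hγ i j h (ih _ (weight_swapParts_lt γ i j h) _ _ rfl)
  · apply antitone
    cases n with
    | zero => exact fun a => a.elim0
    | succ m =>
      refine Fin.antitone_iff_succ_le.2 fun i => not_lt.1 fun hlt => ?_
      exact hex ⟨i.castSucc, i.succ, by simp, hlt⟩

theorem demazureChar_eq_monomial_of_antitone (h : Antitone γ) :
    demazureChar γ = monomial (Finsupp.equivFunOnFinite.symm γ) 1 := by
  rw [demazureChar_of_antitone γ h, monomial_eq, C_1, one_mul,
    Finsupp.prod_fintype _ _ fun _ => pow_zero _]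
  rfl

theorem eq_of_mem_support_demazureChar_of_antitone (h : Antitone γ) {d : Fin n →₀ ℕ}
    (hd : d ∈ (demazureChar γ).support) : ⇑d = γ := by
  rw [demazureChar_eq_monomial_of_antitone h] at hd
  rw [Finset.mem_singleton.1 (support_monomial_subset hd)]
  rfl

theorem coeff_demazureChar_self (hγ : NonzeroAntitone γ) :
    coeff (Finsupp.equivFunOnFinite.symm γ) (demazureChar γ) = 1 := by
  induction γ, hγ using NonzeroAntitone.induction with
  | antitone γ hγ h => rw [demazureChar_eq_monomial_of_antitone h, coeff_monomial, if_pos rfl]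
  | ascent γ hγ i j h ih =>
    rw [demazureChar_of_isAscent γ i j h, coeff_demazureOp_of_apply_left_eq_zero h.lt.ne, ← ih]
    · congr 1
      ext p
      exact mapDomain_swap_apply _ p
    · exact hγ.eq_zero_of_isAscent h

theorem Ici_eq_insert_of_isAscent (h : IsAscent γ i j) :
    Finset.Ici i = insert i (Finset.Ici j) := by
  ext p
  simp only [Finset.mem_insert, Finset.mem_Ici, ← h.lt_iff_le, le_iff_eq_or_lt, eq_comm]

theorem IsAscent.lt_of_not_le (h : IsAscent γ i j) {q : Fin n} (hqi : ¬q ≤ i) (hqj : q ≠ j) :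
    j < q :=
  (h.lt_iff_le.1 (not_le.1 hqi)).lt_of_ne hqj.symm

theorem sum_Ici_eq_of_isAscent (h : IsAscent γ i j) {u v : Fin n → ℕ}
    (hoff : ∀ p, p ≠ i → p ≠ j → u p = v p) (hsum : u i + u j = v i + v j)
    {q : Fin n} (hq : q ≠ j) : ∑ p ∈ Finset.Ici q, u p = ∑ p ∈ Finset.Ici q, v p := by
  by_cases hqi : q ≤ i
  · have hsub : ({i, j} : Finset (Fin n)) ⊆ Finset.Ici q := by
      simp [Finset.insert_subset_iff, hqi, hqi.trans h.lt.le]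
    rw [← Finset.sum_sdiff hsub, ← Finset.sum_sdiff hsub, Finset.sum_pair h.lt.ne,
      Finset.sum_pair h.lt.ne, hsum]
    refine congrArg (· + _) (Finset.sum_congr rfl fun p hp => ?_)
    simp only [Finset.mem_sdiff, Finset.mem_insert, Finset.mem_singleton, not_or] at hp
    exact hoff p hp.2.1 hp.2.2
  · refine Finset.sum_congr rfl fun p hp => ?_
    have hjp := (h.lt_of_not_le hqi hq).trans_le (Finset.mem_Ici.1 hp)
    exact hoff p (h.lt.trans hjp).ne' hjp.ne'

theorem sum_le_of_mem_support_demazureChar (hγ : NonzeroAntitone γ) {d : Fin n →₀ ℕ}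
    (hd : d ∈ (demazureChar γ).support) (q : Fin n) :
    ∑ p ∈ Finset.Ici q, d p ≤ ∑ p ∈ Finset.Ici q, γ p := by
  induction γ, hγ using NonzeroAntitone.induction generalizing d q with
  | antitone γ _ h => rw [eq_of_mem_support_demazureChar_of_antitone h hd]
  | ascent γ hγ i j h ih =>
    rw [demazureChar_of_isAscent γ i j h] at hd
    obtain ⟨a, ha, hoff, hsum, -⟩ := exists_mem_support_of_mem_support_demazureOp h.lt.ne hd
    have hle : ∀ q, q ≠ j → ∑ p ∈ Finset.Ici q, d p ≤ ∑ p ∈ Finset.Ici q, γ p := fun q hq =>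
      calc ∑ p ∈ Finset.Ici q, d p = ∑ p ∈ Finset.Ici q, a p :=
            sum_Ici_eq_of_isAscent h hoff hsum hq
        _ ≤ ∑ p ∈ Finset.Ici q, swapParts γ i j p := ih ha q
        _ = ∑ p ∈ Finset.Ici q, γ p :=
            sum_Ici_eq_of_isAscent h (fun _ => swapParts_apply_of_ne γ)
              (by rw [swapParts_apply_left, swapParts_apply_right, add_comm]) hq
    by_cases hqj : q = j
    · have hi := hle i h.lt.ne
      have hij : i ∉ Finset.Ici j := by simp [h.lt]
      rw [Ici_eq_insert_of_isAscent h, Finset.sum_insert hij, Finset.sum_insert hij,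
        hγ.eq_zero_of_isAscent h, zero_add] at hi
      rw [hqj]
      exact (Nat.le_add_left _ _).trans hi
    · exact hle q hqj

theorem sup_Ici_swapParts_le (hγ : NonzeroAntitone γ) (h : IsAscent γ i j) (q : Fin n) :
    (Finset.Ici q).sup (swapParts γ i j) ≤ (Finset.Ici q).sup γ := by
  refine Finset.sup_le fun p hp => ?_
  by_cases hpi : p = i
  · rw [hpi, swapParts_apply_left]
    rw [hpi, Finset.mem_Ici] at hp
    exact Finset.le_sup (Finset.mem_Ici.2 (hp.trans h.lt.le))
  by_cases hpj : p = j
  · rw [hpj, swapParts_apply_right, hγ.eq_zero_of_isAscent h]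
    exact Nat.zero_le _
  · rw [swapParts_apply_of_ne γ hpi hpj]
    exact Finset.le_sup hp

theorem apply_le_sup_of_mem_support_demazureChar (hγ : NonzeroAntitone γ) {d : Fin n →₀ ℕ}
    (hd : d ∈ (demazureChar γ).support) (q : Fin n) : d q ≤ (Finset.Ici q).sup γ := by
  induction γ, hγ using NonzeroAntitone.induction generalizing d q with
  | antitone γ _ h =>
    rw [eq_of_mem_support_demazureChar_of_antitone h hd]
    exact Finset.le_sup (f := γ) (Finset.mem_Ici.2 le_rfl)
  | ascent γ hγ i j h ih =>
    rw [demazureChar_of_isAscent γ i j h] at hd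
    obtain ⟨a, ha, hoff, -, hmax⟩ := exists_mem_support_of_mem_support_demazureOp h.lt.ne hd
    have ha' : ∀ q, a q ≤ (Finset.Ici q).sup γ := fun q =>
      (ih ha q).trans (sup_Ici_swapParts_le hγ h q)
    have hsup : (Finset.Ici i).sup γ = (Finset.Ici j).sup γ := by
      rw [Ici_eq_insert_of_isAscent h, Finset.sup_insert, hγ.eq_zero_of_isAscent h]
      exact max_eq_right (Nat.zero_le _)
    have hd' : max (d i) (d j) ≤ (Finset.Ici j).sup γ :=
      hmax.trans (max_le ((ha' i).trans_eq hsup) (ha' j))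
    by_cases hqi : q = i
    · rw [hqi, hsup]
      exact (le_max_left _ _).trans hd'
    by_cases hqj : q = j
    · rw [hqj]
      exact (le_max_right _ _).trans hd'
    · rw [hoff q hqi hqj]
      exact ha' q

end DemazureChar

/-! ### Products of linear and geometric series -/

section Series

variable {A B ι : Type*} [CommRing A] [CommRing B]

/-- The power series `1 - a t`. -/
def linSeries (a : A) : PowerSeries A := 1 - PowerSeries.C a * PowerSeries.X

/-- The power series `1 / (1 - a t)`. -/
def geomSeries (a : A) : PowerSeries A := PowerSeries.mk fun c => a ^ c

theorem linSeries_mul_geomSeries (a : A) : linSeries a * geomSeries a = 1 := by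
  ext c
  rw [linSeries, sub_mul, one_mul, mul_assoc, map_sub, PowerSeries.coeff_C_mul]
  cases c with
  | zero => simp [geomSeries]
  | succ c => simp [geomSeries, PowerSeries.coeff_succ_X_mul, PowerSeries.coeff_one, pow_succ']

theorem prod_linSeries_mul_prod_geomSeries (s : Finset ι) (f : ι → A) :
    (∏ p ∈ s, linSeries (f p)) * ∏ p ∈ s, geomSeries (f p) = 1 := by
  rw [← Finset.prod_mul_distrib, Finset.prod_eq_one fun p _ => linSeries_mul_geomSeries _]

theorem C_sub_C_mul_geomSeries_mul_geomSeries (a b : A) :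
    (PowerSeries.C a - PowerSeries.C b) * (geomSeries a * geomSeries b)
      = PowerSeries.C a * geomSeries a - PowerSeries.C b * geomSeries b := by
  have ha := linSeries_mul_geomSeries a
  have hb := linSeries_mul_geomSeries b
  unfold linSeries at ha hb
  linear_combination PowerSeries.C a * geomSeries a * hb - PowerSeries.C b * geomSeries b * ha

theorem constantCoeff_linSeries (a : A) : PowerSeries.constantCoeff (linSeries a) = 1 := by
  simp [linSeries]

theorem constantCoeff_prod_linSeries (s : Finset ι) (f : ι → A) :
    PowerSeries.constantCoeff (∏ p ∈ s, linSeries (f p)) = 1 := by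
  rw [map_prod, Finset.prod_eq_one fun p _ => constantCoeff_linSeries (f p)]

theorem constantCoeff_geomSeries (a : A) : PowerSeries.constantCoeff (geomSeries a) = 1 := by
  simp [geomSeries]

theorem map_linSeries (φ : A →+* B) (a : A) :
    PowerSeries.map φ (linSeries a) = linSeries (φ a) := by
  simp [linSeries]

theorem map_geomSeries (φ : A →+* B) (a : A) :
    PowerSeries.map φ (geomSeries a) = geomSeries (φ a) := by
  ext; simp [geomSeries]

theorem map_coeff_X_pow_mul (φ : A →+* B) (i N : ℕ) (F : PowerSeries A) :
    φ (PowerSeries.coeff N (PowerSeries.X ^ i * F))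
      = PowerSeries.coeff N (PowerSeries.X ^ i * PowerSeries.map φ F) := by
  rw [← PowerSeries.coeff_map, map_mul, map_pow, PowerSeries.map_X]

theorem prod_linSeries_eq_sum_powerset (s : Finset ι) (f : ι → A) :
    ∏ p ∈ s, linSeries (f p)
      = ∑ t ∈ s.powerset, PowerSeries.C (∏ p ∈ t, -f p) * PowerSeries.X ^ t.card := by
  classical
  simp only [linSeries, sub_eq_add_neg, Finset.prod_one_add]
  refine Finset.sum_congr rfl fun t _ => ?_
  rw [map_prod, ← Finset.prod_const, ← Finset.prod_mul_distrib]
  exact Finset.prod_congr rfl fun p _ => by rw [map_neg, neg_mul]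

theorem coeff_prod_linSeries (s : Finset ι) (f : ι → A) (c : ℕ) :
    PowerSeries.coeff c (∏ p ∈ s, linSeries (f p))
      = (-1) ^ c * ∑ t ∈ s.powersetCard c, ∏ p ∈ t, f p := by
  rw [prod_linSeries_eq_sum_powerset, map_sum, Finset.mul_sum, Finset.powersetCard_eq_filter,
    Finset.sum_filter]
  refine Finset.sum_congr rfl fun t _ => ?_
  rw [PowerSeries.coeff_C_mul, PowerSeries.coeff_X_pow, Finset.prod_neg, mul_ite, mul_one, mul_zero]
  refine ite_congr (propext eq_comm) (fun h => ?_) fun _ => rfl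
  rw [h]

theorem coeff_prod_linSeries_of_card_lt {s : Finset ι} (f : ι → A) {c : ℕ} (h : s.card < c) :
    PowerSeries.coeff c (∏ p ∈ s, linSeries (f p)) = 0 := by
  rw [coeff_prod_linSeries, Finset.powersetCard_eq_empty.2 h, Finset.sum_empty, mul_zero]

theorem sum_coeff_mul_coeff_X_pow_mul {m : ℕ} (F G : PowerSeries A) (N : ℕ) (j : Fin m)
    (hG : ∀ c, (j : ℕ) < c → PowerSeries.coeff c G = 0) :
    ∑ l : Fin m, PowerSeries.coeff (N + l) F * PowerSeries.coeff j (PowerSeries.X ^ (l : ℕ) * G)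
      = PowerSeries.coeff (N + j) (F * G) := by
  have hLHS : ∑ l : Fin m, PowerSeries.coeff (N + l) F *
      PowerSeries.coeff j (PowerSeries.X ^ (l : ℕ) * G)
      = ∑ l ∈ Finset.range (j + 1), PowerSeries.coeff (N + l) F * PowerSeries.coeff (j - l) G := by
    rw [Fin.sum_univ_eq_sum_range fun l => PowerSeries.coeff (N + l) F *
      PowerSeries.coeff (j : ℕ) (PowerSeries.X ^ l * G)]
    have hzero : ∀ l ∈ Finset.range m, l ∉ Finset.range (j + 1) → PowerSeries.coeff (N + l) F *
        PowerSeries.coeff (j : ℕ) (PowerSeries.X ^ l * G) = 0 := by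
      intro l _ hl
      rw [Finset.mem_range] at hl
      rw [PowerSeries.coeff_X_pow_mul', if_neg (by omega), mul_zero]
    rw [← Finset.sum_subset (Finset.range_subset_range.2 j.isLt) hzero]
    refine Finset.sum_congr rfl fun l hl => ?_
    rw [PowerSeries.coeff_X_pow_mul', if_pos (Finset.mem_range_succ_iff.1 hl)]
  rw [hLHS, mul_comm F G, PowerSeries.coeff_mul, Finset.Nat.sum_antidiagonal_eq_sum_range_succ_mk,
    ← Finset.sum_range_reflect]
  have hzero : ∀ c ∈ Finset.range (N + j).succ, c ∉ Finset.range (j + 1) →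
      PowerSeries.coeff c G * PowerSeries.coeff (N + j - c) F = 0 := by
    intro c _ hc
    rw [hG c (by simpa using hc), zero_mul]
  rw [← Finset.sum_subset (Finset.range_subset_range.2 (by omega)) hzero]
  refine Finset.sum_congr rfl fun c hc => ?_
  rw [Finset.mem_range] at hc
  rw [mul_comm]
  congr 3 <;> omega

theorem det_mul_eq_zero_of_mulVec_eq_zero {κ : Type*} [Fintype κ] [DecidableEq κ]
    {M : Matrix κ κ A} {v : κ → A} (h : M.mulVec v = 0) (l : κ) : M.det * v l = 0 := by
  have hadj := congrArg M.adjugate.mulVec h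
  rw [Matrix.mulVec_mulVec, Matrix.adjugate_mul, Matrix.smul_mulVec, Matrix.one_mulVec,
    Matrix.mulVec_zero] at hadj
  exact congrFun hadj l

end Series

/-! ### The flagged Jacobi–Trudi formula -/

section JacobiTrudi

variable {n m : ℕ} (R : Type*) [CommRing R]

/-- The generating series `∏_{p ≤ b} 1 / (1 - x_p t)` of the complete homogeneous polynomials in
the variables up to `b`. -/
def flagSeries (b : Fin n) : PowerSeries (MvPolynomial (Fin n) R) :=
  ∏ p ∈ Finset.Iic b, geomSeries (X p)

/-- The flagged Jacobi–Trudi matrix `(h_{lam i - i + j}(x_1, …, x_{b i}))_{i j}`. Multiplying the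
series by `t ^ i` makes the entries with negative `lam i - i + j` vanish and avoids the
subtraction. -/
def jacobiTrudi (b : Fin m → Fin n) (lam : Fin m → ℕ) :
    Matrix (Fin m) (Fin m) (MvPolynomial (Fin n) R) :=
  Matrix.of fun i j =>
    PowerSeries.coeff (lam i + j) (PowerSeries.X ^ (i : ℕ) * flagSeries R (b i))

variable {R}

theorem jacobiTrudi_apply (b : Fin m → Fin n) (lam : Fin m → ℕ) (i j : Fin m) :
    jacobiTrudi R b lam i j
      = PowerSeries.coeff (lam i + j) (PowerSeries.X ^ (i : ℕ) * flagSeries R (b i)) :=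
  rfl

theorem flagSeries_eq_geomSeries_mul (b : Fin n) :
    flagSeries R b = geomSeries (X b) * ∏ p ∈ Finset.Iio b, geomSeries (X p) := by
  rw [flagSeries, ← Finset.Iio_insert, Finset.prod_insert (by simp)]

theorem Iic_eq_insert_Iic_of_add_one_eq {p q : Fin n} (h : (p : ℕ) + 1 = q) :
    Finset.Iic q = insert q (Finset.Iic p) := by
  ext l
  simp only [Finset.mem_Iic, Finset.mem_insert, Fin.le_def, Fin.ext_iff]
  omega

theorem flagSeries_of_add_one_eq {p q : Fin n} (h : (p : ℕ) + 1 = q) :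
    flagSeries R q = geomSeries (X q) * flagSeries R p := by
  rw [flagSeries, Iic_eq_insert_Iic_of_add_one_eq h, Finset.prod_insert]
  · rfl
  · rw [Finset.mem_Iic, Fin.le_def]
    omega

theorem flagSeries_mul_prod_linSeries {b : Fin n} {s : Finset (Fin n)} (h : Finset.Iic b ⊆ s) :
    flagSeries R b * ∏ p ∈ s, linSeries (X p) = ∏ p ∈ s \ Finset.Iic b, linSeries (X p) := by
  rw [← Finset.prod_sdiff h, flagSeries, mul_left_comm, mul_comm (∏ p ∈ Finset.Iic b, _),
    prod_linSeries_mul_prod_geomSeries, mul_one]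

theorem flagSeries_mul_prod_Iio_linSeries (b : Fin n) :
    flagSeries R b * ∏ p ∈ Finset.Iio b, linSeries (X p) = geomSeries (X b) := by
  rw [flagSeries_eq_geomSeries_mul, mul_assoc, mul_comm (∏ p ∈ Finset.Iio b, _),
    prod_linSeries_mul_prod_geomSeries, mul_one]

theorem map_swap_flagSeries_self {p q : Fin n} (h : (p : ℕ) + 1 = q)
    {φ : MvPolynomial (Fin n) R →+* MvPolynomial (Fin n) R}
    (hφ : ∀ l, φ (X l) = X (Equiv.swap p q l)) :
    PowerSeries.map φ (flagSeries R p)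
      = geomSeries (X q) * ∏ l ∈ Finset.Iio p, geomSeries (X l) := by
  rw [flagSeries_eq_geomSeries_mul, map_mul, map_prod, map_geomSeries, hφ, Equiv.swap_apply_left]
  refine congrArg _ (Finset.prod_congr rfl fun l hl => ?_)
  have hlp := Finset.mem_Iio.1 hl
  have hlq : l < q := hlp.trans (Fin.lt_def.2 (by omega))
  rw [map_geomSeries, hφ, Equiv.swap_apply_of_ne_of_ne hlp.ne hlq.ne]

theorem map_swap_flagSeries_of_ne {p q b : Fin n} (h : (p : ℕ) + 1 = q) (hb : b ≠ p)
    {φ : MvPolynomial (Fin n) R →+* MvPolynomial (Fin n) R}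
    (hφ : ∀ l, φ (X l) = X (Equiv.swap p q l)) :
    PowerSeries.map φ (flagSeries R b) = flagSeries R b := by
  rw [flagSeries, map_prod]
  refine Finset.prod_bijective (Equiv.swap p q) (Equiv.bijective _) (fun l => ?_) fun l _ => ?_
  · simp only [Finset.mem_Iic, Equiv.swap_apply_def, Fin.le_def, ne_eq, Fin.ext_iff] at hb ⊢
    split_ifs <;> omega
  · rw [map_geomSeries, hφ]

theorem demazureOp_coeff_flagSeries {p q : Fin n} (h : (p : ℕ) + 1 = q) (i N : ℕ) :
    demazureOp p q (PowerSeries.coeff N (PowerSeries.X ^ i * flagSeries ℂ p))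
      = PowerSeries.coeff N (PowerSeries.X ^ i * flagSeries ℂ q) := by
  apply demazureOp_eq_of_spec (by rintro rfl; omega)
  let φ : MvPolynomial (Fin n) ℂ →+* MvPolynomial (Fin n) ℂ := swapVars p q
  have hφ : ∀ l, φ (X l) = X (Equiv.swap p q l) := fun l => rename_X _ l
  have hswap := map_coeff_X_pow_mul φ i N (flagSeries ℂ p)
  rw [map_swap_flagSeries_self h hφ, RingHom.coe_coe] at hswap
  rw [hswap, ← PowerSeries.coeff_C_mul, ← PowerSeries.coeff_C_mul, ← PowerSeries.coeff_C_mul,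
    ← map_sub, flagSeries_of_add_one_eq h, flagSeries_eq_geomSeries_mul p, map_sub]
  congr 1
  linear_combination (PowerSeries.X ^ i * ∏ l ∈ Finset.Iio p, geomSeries (X l)) *
    C_sub_C_mul_geomSeries_mul_geomSeries (X p : MvPolynomial (Fin n) ℂ) (X q)

theorem demazureOp_det_jacobiTrudi {b : Fin m → Fin n} (hb : Function.Injective b)
    (lam : Fin m → ℕ) {j : Fin m} {p : Fin n} (hp : (p : ℕ) + 1 = b j) (hbp : ∀ l, b l ≠ p) :
    demazureOp p (b j) (jacobiTrudi ℂ (Equiv.swap p (b j) ∘ b) lam).det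
      = (jacobiTrudi ℂ b lam).det := by
  have hrow : ∀ v, (jacobiTrudi ℂ (Equiv.swap p (b j) ∘ b) lam).updateRow j v
      = (jacobiTrudi ℂ b lam).updateRow j v := by
    intro v
    ext1 i l
    by_cases hi : i = j
    · rw [hi, Matrix.updateRow_self, Matrix.updateRow_self]
    · rw [Matrix.updateRow_ne hi, Matrix.updateRow_ne hi, jacobiTrudi_apply, jacobiTrudi_apply,
        Function.comp_apply, Equiv.swap_apply_of_ne_of_ne (hbp i) (hb.ne hi)]
  -- Only row `j` changes, so `demazureOp` acts on the expansion along it through that row alone.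
  rw [Matrix.det_eq_sum_mul_adjugate_row _ j, Matrix.det_eq_sum_mul_adjugate_row _ j]
  simp only [Matrix.adjugate_apply, hrow]
  simp only [mul_comm _ (Matrix.det _)]
  rw [demazureOp_sum (hbp j).symm]
  · refine Finset.sum_congr rfl fun l _ => ?_
    rw [jacobiTrudi_apply, jacobiTrudi_apply, Function.comp_apply, Equiv.swap_apply_right,
      demazureOp_coeff_flagSeries hp]
  · intro l _
    rw [AlgHom.map_det]
    congr 1
    ext1 i c
    rw [AlgHom.mapMatrix_apply, Matrix.map_apply]
    by_cases hi : i = j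
    · rw [hi, Matrix.updateRow_self, Pi.single_apply, apply_ite (swapVars p (b j)),
        map_one, map_zero]
    · rw [Matrix.updateRow_ne hi, jacobiTrudi_apply]
      let φ : MvPolynomial (Fin n) ℂ →+* MvPolynomial (Fin n) ℂ := swapVars p (b j)
      have hφ : ∀ l, φ (X l) = X (Equiv.swap p (b j) l) := fun l => rename_X _ l
      have hswap := map_coeff_X_pow_mul φ i (lam i + c) (flagSeries ℂ (b i))
      rwa [map_swap_flagSeries_of_ne hp (hbp i) hφ] at hswap

/-- The matrix by which one multiplies `jacobiTrudi R b lam` to clear its denominators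
`∏_{p < b j} (1 - x_p t)` when `b j = j` for all `j`. -/
def clearingMatrix (R : Type*) [CommRing R] (b : Fin m → Fin n) :
    Matrix (Fin m) (Fin m) (MvPolynomial (Fin n) R) :=
  Matrix.of fun l j => PowerSeries.coeff j
    (PowerSeries.X ^ (l : ℕ) * ∏ p ∈ Finset.Iio (b j), linSeries (X p))

theorem det_clearingMatrix (b : Fin m → Fin n) : (clearingMatrix R b).det = 1 := by
  rw [Matrix.det_of_isUpperTriangular]
  · refine Finset.prod_eq_one fun j _ => ?_
    rw [clearingMatrix, Matrix.of_apply, PowerSeries.coeff_X_pow_mul', if_pos le_rfl, Nat.sub_self,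
      PowerSeries.coeff_zero_eq_constantCoeff_apply, constantCoeff_prod_linSeries]
  · intro l j (hlj : j < l)
    rw [clearingMatrix, Matrix.of_apply, PowerSeries.coeff_X_pow_mul',
      if_neg (not_le.2 (Fin.lt_def.1 hlj))]

theorem jacobiTrudi_mul_clearingMatrix {b : Fin m → Fin n} (hb : ∀ j, (b j : ℕ) = j)
    (lam : Fin m → ℕ) (i j : Fin m) :
    (jacobiTrudi R b lam * clearingMatrix R b) i j = PowerSeries.coeff (lam i + j)
      (PowerSeries.X ^ (i : ℕ) *
        (flagSeries R (b i) * ∏ p ∈ Finset.Iio (b j), linSeries (X p))) := by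
  rw [Matrix.mul_apply, ← mul_assoc, ← sum_coeff_mul_coeff_X_pow_mul]
  · rfl
  · intro c hc
    apply coeff_prod_linSeries_of_card_lt
    rwa [Fin.card_Iio, hb]

theorem det_jacobiTrudi_of_forall_val_eq {b : Fin m → Fin n} (hb : ∀ j, (b j : ℕ) = j)
    (lam : Fin m → ℕ) : (jacobiTrudi R b lam).det = ∏ j, X (b j) ^ lam j := by
  rw [← mul_one (Matrix.det _), ← det_clearingMatrix b, ← Matrix.det_mul,
    Matrix.det_of_isLowerTriangular]
  · refine Finset.prod_congr rfl fun i _ => ?_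
    rw [jacobiTrudi_mul_clearingMatrix hb, flagSeries_mul_prod_Iio_linSeries,
      PowerSeries.coeff_X_pow_mul, geomSeries, PowerSeries.coeff_mk]
  · intro i j hij
    have hij' : (i : ℕ) < j := hij
    have hsub : Finset.Iic (b i) ⊆ Finset.Iio (b j) := fun l hl =>
      Finset.mem_Iio.2 ((Finset.mem_Iic.1 hl).trans_lt (by rwa [Fin.lt_def, hb, hb]))
    rw [jacobiTrudi_mul_clearingMatrix hb, flagSeries_mul_prod_linSeries hsub,
      PowerSeries.coeff_X_pow_mul', if_pos (by omega), coeff_prod_linSeries_of_card_lt]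
    rw [Finset.card_sdiff_of_subset hsub, Fin.card_Iio, Fin.card_Iic, hb, hb]
    omega

theorem val_eq_of_antitone_of_range_eq {γ : Fin n → ℕ} (hγ : Antitone γ) {b : Fin m → Fin n}
    (hb : StrictMono b) (hrange : ∀ p, γ p ≠ 0 ↔ p ∈ Set.range b) (j : Fin m) : (b j : ℕ) = j := by
  have hIic : Finset.Iic (b j) = (Finset.Iic j).map ⟨b, hb.injective⟩ := by
    ext p
    simp only [Finset.mem_Iic, Finset.mem_map, Function.Embedding.coeFn_mk]
    constructor
    · intro hp
      have hbj : 0 < γ (b j) := Nat.pos_of_ne_zero ((hrange _).2 ⟨j, rfl⟩)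
      obtain ⟨l, rfl⟩ := (hrange p).1 (hbj.trans_le (hγ hp)).ne'
      exact ⟨l, hb.le_iff_le.1 hp, rfl⟩
    · rintro ⟨l, hl, rfl⟩
      exact hb.monotone hl
  have hcard := congrArg Finset.card hIic
  rw [Finset.card_map, Fin.card_Iic, Fin.card_Iic] at hcard
  exact Nat.succ_injective hcard

theorem demazureChar_eq_det_jacobiTrudi {γ : Fin n → ℕ} (hγ : NonzeroAntitone γ)
    {b : Fin m → Fin n} (hb : StrictMono b) (hrange : ∀ p, γ p ≠ 0 ↔ p ∈ Set.range b) :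
    demazureChar γ = (jacobiTrudi ℂ b (γ ∘ b)).det := by
  induction γ, hγ using NonzeroAntitone.induction generalizing b with
  | antitone γ _ h =>
    rw [det_jacobiTrudi_of_forall_val_eq (val_eq_of_antitone_of_range_eq h hb hrange),
      demazureChar_of_antitone γ h]
    refine (Fintype.prod_of_injective b hb.injective _ _ (fun p hp => ?_) fun j => rfl).symm
    rw [of_not_not fun h0 => hp ((hrange p).1 h0), pow_zero]
  | ascent γ hγ i j h ih =>
    obtain ⟨l, rfl⟩ := (hrange j).1 (Nat.ne_zero_of_lt h.2)
    have hi : ∀ x, b x ≠ i := fun x hx => (hrange i).2 ⟨x, hx⟩ (hγ.eq_zero_of_isAscent h)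
    have hb' : StrictMono (Equiv.swap i (b l) ∘ b) := fun x y hxy =>
      h.swap_lt_swap (hb hxy) fun hx => absurd hx (hi x)
    have hrange' : ∀ p, swapParts γ i (b l) p ≠ 0 ↔ p ∈ Set.range (Equiv.swap i (b l) ∘ b) := by
      intro p
      rw [swapParts, Function.comp_apply, hrange, Set.range_comp, Equiv.image_eq_preimage_symm,
        Equiv.symm_swap, Set.mem_preimage]
    have hparts : swapParts γ i (b l) ∘ Equiv.swap i (b l) ∘ b = γ ∘ b := by
      funext x
      simp only [swapParts, Function.comp_apply, Equiv.swap_apply_self]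
    rw [demazureChar_of_isAscent γ i _ h, ih hb' hrange', hparts,
      demazureOp_det_jacobiTrudi hb.injective _ h.1 hi]

theorem coeff_flagSeries_mul_prod_linSeries_eq_zero (b : Fin n) {i N : ℕ} (h : n < N + 1 + b - i) :
    PowerSeries.coeff N (PowerSeries.X ^ i * (flagSeries R b * ∏ p, linSeries (X p))) = 0 := by
  rw [flagSeries_mul_prod_linSeries (Finset.subset_univ _), PowerSeries.coeff_X_pow_mul']
  split_ifs
  · apply coeff_prod_linSeries_of_card_lt
    rw [Finset.card_sdiff_of_subset (Finset.subset_univ _), Fin.card_Iic, Finset.card_univ,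
      Fintype.card_fin]
    omega
  · rfl

theorem coeff_prod_linSeries_X_mem {I : Ideal (MvPolynomial (Fin n) R)}
    (hI : ∀ d, m < d → d ≤ n → esymm (Fin n) R d ∈ I) {c : ℕ} (hc : m < c) :
    PowerSeries.coeff c (∏ p : Fin n, linSeries (X p : MvPolynomial (Fin n) R)) ∈ I := by
  by_cases hcn : c ≤ n
  · rw [coeff_prod_linSeries]
    exact I.mul_mem_left _ (hI c hc hcn)
  · rw [coeff_prod_linSeries_of_card_lt]
    · exact I.zero_mem
    · simpa using hcn

/-- Modulo `I` the polynomial `∏ p, (1 - x_p t)` has degree at most `m`, so its coefficients form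
a vector, with last entry `1`, in the kernel of the Jacobi–Trudi matrix. -/
theorem det_jacobiTrudi_mem (b : Fin (m + 1) → Fin n) (lam : Fin (m + 1) → ℕ)
    (hlam : ∀ j, n + j ≤ lam j + m + b j)
    {I : Ideal (MvPolynomial (Fin n) R)} (hI : ∀ d, m < d → d ≤ n → esymm (Fin n) R d ∈ I) :
    (jacobiTrudi R b lam).det ∈ I := by
  let φ := Ideal.Quotient.mk I
  let G : PowerSeries (MvPolynomial (Fin n) R) := ∏ p : Fin n, linSeries (X p)
  let v : Fin (m + 1) → MvPolynomial (Fin n) R ⧸ I := fun l =>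
    PowerSeries.coeff (Fin.last m) (PowerSeries.X ^ (l : ℕ) * PowerSeries.map φ G)
  have hG : ∀ c, (Fin.last m : ℕ) < c → PowerSeries.coeff c (PowerSeries.map φ G) = 0 := by
    intro c hc
    rw [PowerSeries.coeff_map]
    exact Ideal.Quotient.eq_zero_iff_mem.2 (coeff_prod_linSeries_X_mem hI hc)
  have hker : (φ.mapMatrix (jacobiTrudi R b lam)).mulVec v = 0 := by
    funext i
    have hsum : (φ.mapMatrix (jacobiTrudi R b lam)).mulVec v i
        = ∑ l : Fin (m + 1), PowerSeries.coeff (lam i + l)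
          (PowerSeries.X ^ (i : ℕ) * PowerSeries.map φ (flagSeries R (b i))) * v l := by
      rw [Matrix.mulVec, dotProduct]
      exact Finset.sum_congr rfl fun l _ =>
        congrArg (· * v l) (map_coeff_X_pow_mul φ i (lam i + l) (flagSeries R (b i)))
    rw [hsum, sum_coeff_mul_coeff_X_pow_mul _ _ _ _ hG, mul_assoc, ← map_mul,
      ← map_coeff_X_pow_mul, coeff_flagSeries_mul_prod_linSeries_eq_zero, map_zero, Pi.zero_apply]
    have hi := hlam i
    have := i.isLt
    rw [Fin.val_last]
    omega
  have hv : v (Fin.last m) = 1 := by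
    simp only [v, G]
    rw [PowerSeries.coeff_X_pow_mul', if_pos le_rfl, Nat.sub_self, PowerSeries.coeff_map,
      PowerSeries.coeff_zero_eq_constantCoeff_apply, constantCoeff_prod_linSeries, map_one]
  rw [← Ideal.Quotient.eq_zero_iff_mem, RingHom.map_det, ← mul_one (Matrix.det _), ← hv]
  exact det_mul_eq_zero_of_mulVec_eq_zero hker _

end JacobiTrudi

/-! ### Interpolation on point sets -/

section Points

variable {R α : Type*} [DecidableEq α]

/-- Reading an exponent from left to right with threshold `(k + 1 - u) * r`, where `u` counts the
entries below the threshold which are still required; each such entry raises the threshold by `r`.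
The exponent is standard if the required number of such entries occurs. -/
def IsStandard (k r : ℕ) : (n : ℕ) → ℕ → (Fin n → ℕ) → Prop
  | 0, u, _ => u = 0
  | n + 1, u, d => IsStandard k r n (if (k + 1 - u) * r ≤ d 0 then u else u - 1) (Fin.tail d)

/-- The elements of `A` occurring in the tuple `y`. -/
def hit {n : ℕ} (A : Finset α) (y : Fin n → α) : Finset α :=
  A.filter fun a => ∃ i, y i = a

theorem isStandard_cons {k r n u e : ℕ} {d : Fin n →₀ ℕ} :
    IsStandard k r (n + 1) u (d.cons e)
      ↔ IsStandard k r n (if (k + 1 - u) * r ≤ e then u else u - 1) d :=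
  Iff.rfl

theorem hit_subset {n : ℕ} (A : Finset α) (y : Fin n → α) : hit A y ⊆ A :=
  Finset.filter_subset _ _

theorem hit_subset_hit_cons {n : ℕ} (A : Finset α) (b : α) (y : Fin n → α) :
    hit A y ⊆ hit A (Fin.cons b y : Fin (n + 1) → α) := by
  intro a ha
  obtain ⟨haA, i, hi⟩ := Finset.mem_filter.1 ha
  exact Finset.mem_filter.2 ⟨haA, i.succ, hi⟩

theorem card_hit_lt_card_hit_cons {n : ℕ} {A : Finset α} {b : α} {y : Fin n → α}
    (hb : b ∈ A \ hit A y) : (hit A y).card < (hit A (Fin.cons b y : Fin (n + 1) → α)).card := by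
  obtain ⟨hbA, hby⟩ := Finset.mem_sdiff.1 hb
  exact Finset.card_lt_card (Finset.ssubset_iff_of_subset (hit_subset_hit_cons A b y) |>.2
    ⟨b, Finset.mem_filter.2 ⟨hbA, 0, rfl⟩, hby⟩)

theorem card_mul_le_card_filter_mem {A B : Finset α} {V : Finset R} {φ : R → α} {r : ℕ}
    (hV : ∀ a ∈ A, r ≤ (V.filter fun v => φ v = a).card) (hB : B ⊆ A) :
    B.card * r ≤ (V.filter fun v => φ v ∈ B).card := by
  rw [← Finset.sum_card_fiberwise_eq_card_filter, ← smul_eq_mul]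
  exact Finset.card_nsmul_le_sum _ _ _ fun a ha => hV a (hB ha)

theorem eq_zero_of_eval_eq_zero_of_isEmpty {R σ : Type*} [CommSemiring R] [IsEmpty σ]
    {F : MvPolynomial σ R} {x : σ → R} (h : eval x F = 0) : F = 0 := by
  rw [eq_C_of_isEmpty F, eval_C] at h
  rw [eq_C_of_isEmpty F, h, map_zero]

variable [CommRing R]

theorem bound_and_isStandard_of_mem_support_coeff_finSuccEquiv {k r n u N : ℕ}
    {F : MvPolynomial (Fin (n + 1)) R}
    (hF : ∀ d ∈ F.support, (∀ i, d i < N) ∧ IsStandard k r (n + 1) u d) {e : ℕ} {d : Fin n →₀ ℕ}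
    (hd : d ∈ ((finSuccEquiv R n F).coeff e).support) :
    e < N ∧ (∀ i, d i < N) ∧ IsStandard k r n (if (k + 1 - u) * r ≤ e then u else u - 1) d :=
  have hFd := hF _ (mem_support_coeff_finSuccEquiv.1 hd)
  ⟨hFd.1 0, fun i => hFd.1 i.succ, isStandard_cons.1 hFd.2⟩

variable [IsDomain R]

theorem eval_coeff_finSuccEquiv_eq_zero {n : ℕ} {F : MvPolynomial (Fin (n + 1)) R} {w : Fin n → R}
    {T : Finset R} (hT : ∀ v ∈ T, eval (Fin.cons v w : Fin (n + 1) → R) F = 0)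
    (hdeg : ∀ e, T.card ≤ e → eval w ((finSuccEquiv R n F).coeff e) = 0) (e : ℕ) :
    eval w ((finSuccEquiv R n F).coeff e) = 0 := by
  have hzero : (finSuccEquiv R n F).map (eval w) = 0 := by
    refine Polynomial.eq_zero_of_degree_lt_of_eval_finset_eq_zero T ?_ fun v hv => ?_
    · rw [Polynomial.degree_lt_iff_coeff_zero]
      intro e he
      rw [Polynomial.coeff_map, hdeg e he]
    · rw [← eval_eq_eval_mv_eval', hT v hv]
  rw [← Polynomial.coeff_map, hzero, Polynomial.coeff_zero]

theorem eval_coeff_finSuccEquiv_eq_zero_of_le_card_hit {A : Finset α} {V : Finset R} {φ : R → α}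
    {n u : ℕ} {F : MvPolynomial (Fin (n + 1)) R} {w : Fin n → R}
    (heval : ∀ v ∈ V, u ≤ (hit A (Fin.cons (φ v) (φ ∘ w) : Fin (n + 1) → α)).card →
      eval (Fin.cons v w : Fin (n + 1) → R) F = 0)
    (hu : u ≤ (hit A (φ ∘ w)).card)
    (hdeg : ∀ e, V.card ≤ e → eval w ((finSuccEquiv R n F).coeff e) = 0) (e : ℕ) :
    eval w ((finSuccEquiv R n F).coeff e) = 0 :=
  eval_coeff_finSuccEquiv_eq_zero (fun v hv => heval v hv
    (hu.trans (Finset.card_le_card (hit_subset_hit_cons _ _ _)))) hdeg e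

theorem eval_coeff_finSuccEquiv_eq_zero_of_card_hit_add_one {A : Finset α} {V : Finset R}
    {φ : R → α} {r : ℕ} (hV : ∀ a ∈ A, r ≤ (V.filter fun v => φ v = a).card)
    {n u : ℕ} {F : MvPolynomial (Fin (n + 1)) R} {w : Fin n → R}
    (heval : ∀ v ∈ V, u ≤ (hit A (Fin.cons (φ v) (φ ∘ w) : Fin (n + 1) → α)).card →
      eval (Fin.cons v w : Fin (n + 1) → R) F = 0)
    (hu : (hit A (φ ∘ w)).card + 1 = u)
    (hdeg : ∀ e, (A.card + 1 - u) * r ≤ e → eval w ((finSuccEquiv R n F).coeff e) = 0) (e : ℕ) :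
    eval w ((finSuccEquiv R n F).coeff e) = 0 := by
  have hcard : (A \ hit A (φ ∘ w)).card = A.card + 1 - u := by
    rw [Finset.card_sdiff_of_subset (hit_subset _ _)]
    omega
  have hle := card_mul_le_card_filter_mem hV (B := A \ hit A (φ ∘ w)) Finset.sdiff_subset
  rw [hcard] at hle
  refine eval_coeff_finSuccEquiv_eq_zero (T := V.filter fun v => φ v ∈ A \ hit A (φ ∘ w))
    (fun v hv => ?_) (fun e' he' => hdeg e' (hle.trans he')) e
  obtain ⟨hvV, hv⟩ := Finset.mem_filter.1 hv
  exact heval v hvV (hu.ge.trans (card_hit_lt_card_hit_cons hv))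

theorem eq_zero_of_isStandard_of_eval_eq_zero {A : Finset α} {V : Finset R} {φ : R → α} {r : ℕ}
    (hV : ∀ a ∈ A, r ≤ (V.filter fun v => φ v = a).card) {n u : ℕ} {F : MvPolynomial (Fin n) R}
    (hF : ∀ d ∈ F.support, (∀ i, d i < V.card) ∧ IsStandard A.card r n u d)
    (h : ∀ x : Fin n → R, (∀ i, x i ∈ V) → u ≤ (hit A (φ ∘ x)).card → eval x F = 0) : F = 0 := by
  induction n generalizing u with
  | zero =>
    by_contra hF0
    obtain ⟨d, hd⟩ := support_nonempty.2 hF0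
    obtain rfl : u = 0 := (hF d hd).2
    exact hF0 (eq_zero_of_eval_eq_zero_of_isEmpty (h finZeroElim finZeroElim (Nat.zero_le _)))
  | succ n ih =>
    let P := finSuccEquiv R n F
    have hP : ∀ e, ∀ d ∈ (P.coeff e).support, e < V.card ∧ (∀ i, d i < V.card) ∧
        IsStandard A.card r n (if (A.card + 1 - u) * r ≤ e then u else u - 1) d :=
      fun e d hd => bound_and_isStandard_of_mem_support_coeff_finSuccEquiv hF hd
    have heval : ∀ w, (∀ i, w i ∈ V) → ∀ v ∈ V,
        u ≤ (hit A (Fin.cons (φ v) (φ ∘ w) : Fin (n + 1) → α)).card →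
        eval (Fin.cons v w : Fin (n + 1) → R) F = 0 := fun w hw v hv hu =>
      h _ (Fin.cases hv hw) (by rwa [Fin.comp_cons])
    have hmany : ∀ w : Fin n → R, (∀ i, w i ∈ V) → u ≤ (hit A (φ ∘ w)).card →
        ∀ e, eval w (P.coeff e) = 0 := fun w hw hu =>
      eval_coeff_finSuccEquiv_eq_zero_of_le_card_hit (heval w hw) hu fun e he => by
        rw [support_eq_empty.1 (Finset.eq_empty_of_forall_notMem fun d hd =>
          he.not_gt (hP e d hd).1), map_zero]
    have hhigh : ∀ e, (A.card + 1 - u) * r ≤ e → P.coeff e = 0 := fun e he =>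
      ih (fun d hd => by simpa only [if_pos he] using (hP e d hd).2)
        fun w hw hu => hmany w hw hu e
    have hlow : ∀ e, e < (A.card + 1 - u) * r → P.coeff e = 0 := by
      intro e he
      refine ih (u := u - 1)
        (fun d hd => by simpa only [if_neg he.not_ge] using (hP e d hd).2)
        fun w hw hu => ?_
      by_cases huw : u ≤ (hit A (φ ∘ w)).card
      · exact hmany w hw huw e
      · exact eval_coeff_finSuccEquiv_eq_zero_of_card_hit_add_one hV (heval w hw) (by omega)
          (fun e' he' => by rw [hhigh e' he', map_zero]) e
    refine (map_eq_zero_iff _ (finSuccEquiv R n).injective).1 (Polynomial.ext fun e => ?_)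
    exact (lt_or_ge e _).elim (hlow e) (hhigh e)

end Points

/-! ### Ideals of top forms -/

section TopForms

variable {σ R : Type*} [CommRing R]

/-- The polynomial `F` has degree at most `D`, and its component of degree `D` is that of `f`. -/
def HasTopForm (D : ℕ) (F f : MvPolynomial σ R) : Prop :=
  ∀ d : σ →₀ ℕ, D ≤ d.degree → coeff d F = if d.degree = D then coeff d f else 0

theorem hasTopForm_zero (D : ℕ) : HasTopForm D (0 : MvPolynomial σ R) 0 := fun d _ => by
  rw [coeff_zero, ite_self]

theorem HasTopForm.add {D : ℕ} {F G f g : MvPolynomial σ R} (hF : HasTopForm D F f)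
    (hG : HasTopForm D G g) : HasTopForm D (F + G) (f + g) := fun d hd => by
  rw [coeff_add, hF d hd, hG d hd, coeff_add, ite_add_ite, add_zero]

theorem HasTopForm.monomial_mul {D : ℕ} {F f : MvPolynomial σ R} (hF : HasTopForm D F f)
    (s : σ →₀ ℕ) (a : R) :
    HasTopForm (s.degree + D) (monomial s a * F) (monomial s a * f) := by
  intro d hd
  rw [coeff_monomial_mul', coeff_monomial_mul']
  split_ifs with hs hdeg hdeg
  · obtain ⟨e, rfl⟩ := exists_add_of_le hs
    rw [map_add] at hd hdeg
    rw [add_tsub_cancel_left, hF e (by omega), if_pos (by omega)]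
  · obtain ⟨e, rfl⟩ := exists_add_of_le hs
    rw [map_add] at hd hdeg
    rw [add_tsub_cancel_left, hF e (by omega), if_neg (by omega), mul_zero]
  · rfl
  · rfl

theorem hasTopForm_zero_monomial_mul {D : ℕ} {s : σ →₀ ℕ} (hs : D < s.degree) (a : R)
    (f : MvPolynomial σ R) : HasTopForm D 0 (monomial s a * f) := by
  intro d _
  rw [coeff_monomial_mul', coeff_zero]
  split_ifs with hdeg hle
  · exact absurd (Finsupp.degree_mono hle) (by omega)
  · rfl
  · rfl

theorem hasTopForm_of_isHomogeneous {D : ℕ} {F f : MvPolynomial σ R} (hf : f.IsHomogeneous D)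
    (h : ∀ d : σ →₀ ℕ, D ≤ d.degree → coeff d F = coeff d f) : HasTopForm D F f := by
  intro d hd
  rw [h d hd]
  split_ifs with hdeg
  · rfl
  · exact hf.coeff_eq_zero hdeg

theorem hasTopForm_zero_of_isHomogeneous {D E : ℕ} {f : MvPolynomial σ R} (hf : f.IsHomogeneous D)
    (hDE : D ≠ E) : HasTopForm E 0 f := by
  intro d _
  rw [coeff_zero]
  split_ifs with hdeg
  · rw [hf.coeff_eq_zero (hdeg.trans_ne hDE.symm)]
  · rfl

/-- The ideal generated by the homogeneous components of maximal degree of the elements of `I`.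
It is described as the set of polynomials all of whose homogeneous components arise in this way. -/
def topFormIdeal (I : Ideal (MvPolynomial σ R)) : Ideal (MvPolynomial σ R) where
  carrier := {f | ∀ D, ∃ F ∈ I, HasTopForm D F f}
  zero_mem' D := ⟨0, I.zero_mem, hasTopForm_zero D⟩
  add_mem' hf hg D :=
    have ⟨F, hF, hFf⟩ := hf D
    have ⟨G, hG, hGg⟩ := hg D
    ⟨F + G, I.add_mem hF hG, hFf.add hGg⟩
  smul_mem' c f hf D := by
    rw [smul_eq_mul]
    induction c using MvPolynomial.induction_on' with
    | add p q hp hq =>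
      obtain ⟨F, hF, hFp⟩ := hp
      obtain ⟨G, hG, hGq⟩ := hq
      exact ⟨F + G, I.add_mem hF hG, add_mul p q f ▸ hFp.add hGq⟩
    | monomial s a =>
      by_cases hs : s.degree ≤ D
      · obtain ⟨E, rfl⟩ := exists_add_of_le hs
        obtain ⟨F, hF, hFf⟩ := hf E
        exact ⟨monomial s a * F, I.mul_mem_left _ hF, hFf.monomial_mul s a⟩
      · exact ⟨0, I.zero_mem, hasTopForm_zero_monomial_mul (not_le.1 hs) a f⟩

theorem mem_topFormIdeal_of_isHomogeneous {I : Ideal (MvPolynomial σ R)} {D : ℕ}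
    {F f : MvPolynomial σ R} (hf : f.IsHomogeneous D) (hF : F ∈ I)
    (h : ∀ d : σ →₀ ℕ, D ≤ d.degree → coeff d F = coeff d f) : f ∈ topFormIdeal I := by
  intro E
  by_cases hDE : D = E
  · subst hDE
    exact ⟨F, hF, hasTopForm_of_isHomogeneous hf h⟩
  · exact ⟨0, I.zero_mem, hasTopForm_zero_of_isHomogeneous hf hDE⟩

theorem exists_mem_degLex_degree_eq [LinearOrder σ] [WellFoundedGT σ]
    {I : Ideal (MvPolynomial σ R)} {f : MvPolynomial σ R} (hf : f ∈ topFormIdeal I) (h0 : f ≠ 0) :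
    ∃ F ∈ I, F ≠ 0 ∧ MonomialOrder.degLex.degree F = MonomialOrder.lex.degree f := by
  let m := MonomialOrder.lex.degree f
  obtain ⟨F, hF, hFf⟩ := hf m.degree
  have hm : m ∈ F.support := by
    rw [mem_support_iff, hFf m le_rfl, if_pos rfl, ← mem_support_iff]
    exact MonomialOrder.degree_mem_support h0
  refine ⟨F, hF, support_nonempty.1 ⟨m, hm⟩, MonomialOrder.degLex.toSyn.injective
    (le_antisymm (MonomialOrder.degree_le_iff.2 fun d hd => ?_) (MonomialOrder.le_degree hm))⟩
  rw [MonomialOrder.degLex_le_iff, Finsupp.DegLex.le_iff]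
  rcases lt_or_ge d.degree m.degree with hlt | hge
  · exact Or.inl hlt
  · rw [mem_support_iff, hFf d hge, ite_ne_right_iff, ← mem_support_iff] at hd
    exact Or.inr ⟨hd.1, MonomialOrder.lex_le_iff.1 (MonomialOrder.le_degree hd.2)⟩

end TopForms

section Independence

variable {σ K : Type*} [Field K]

/-- Dividing the tail of `F` by `I` leaves a remainder supported in `S`, so a leading exponent in
`S` would give a nonzero element of `I` supported in `S`. -/
theorem degree_notMem_of_mem {m : MonomialOrder σ} {I : Ideal (MvPolynomial σ K)}
    {S : Set (σ →₀ ℕ)} (hind : ∀ F ∈ I, ↑F.support ⊆ S → F = 0)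
    (hcov : ∀ c ∉ S, ∃ g ∈ I, g ≠ 0 ∧ m.degree g ≤ c) {F : MvPolynomial σ K} (hF : F ∈ I)
    (hF0 : F ≠ 0) : m.degree F ∉ S := by
  classical
  intro hFS
  obtain ⟨q, ρ, hdiv, -, hρ⟩ := m.div_set (B := {G | G ∈ I ∧ G ≠ 0})
    (fun G hG => (MonomialOrder.leadingCoeff_ne_zero_iff.2 hG.2).isUnit) (F - m.leadingTerm F)
  have hq : Finsupp.linearCombination _ (fun G : {G | G ∈ I ∧ G ≠ 0} => (G : MvPolynomial σ K)) q
      ∈ I := I.sum_mem fun G _ => I.mul_mem_left _ G.2.1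
  have hmem : m.leadingTerm F + ρ ∈ I := by
    convert I.sub_mem hF hq using 1
    linear_combination -hdiv
  have hsupp : ((m.leadingTerm F + ρ).support : Set (σ →₀ ℕ)) ⊆ S := by
    intro d hd
    rcases Finset.mem_union.1 (support_add hd) with hd | hd
    · rwa [Finset.mem_singleton.1 (support_monomial_subset hd)]
    · by_contra hdS
      obtain ⟨g, hg, hg0, hle⟩ := hcov d hdS
      exact hρ d hd g ⟨hg, hg0⟩ hle
  have hcoeff := congrArg (coeff (m.degree F)) (hind _ hmem hsupp)
  rw [coeff_add, notMem_support_iff.1 fun hd => hρ _ hd F ⟨hF, hF0⟩ le_rfl,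
    MonomialOrder.leadingTerm, coeff_monomial, if_pos rfl, add_zero, coeff_zero] at hcoeff
  exact MonomialOrder.leadingCoeff_ne_zero_iff.2 hF0 hcoeff

theorem lex_degree_notMem_of_mem_topFormIdeal [LinearOrder σ] [WellFoundedGT σ]
    {I : Ideal (MvPolynomial σ K)} {S : Set (σ →₀ ℕ)}
    (hind : ∀ F ∈ I, ↑F.support ⊆ S → F = 0)
    (hcov : ∀ c ∉ S, ∃ g ∈ topFormIdeal I, g ≠ 0 ∧ MonomialOrder.lex.degree g ≤ c)
    {f : MvPolynomial σ K} (hf : f ∈ topFormIdeal I) (h0 : f ≠ 0) :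
    MonomialOrder.lex.degree f ∉ S := by
  obtain ⟨F, hF, hF0, hdeg⟩ := exists_mem_degLex_degree_eq hf h0
  rw [← hdeg]
  refine degree_notMem_of_mem hind (fun c hc => ?_) hF hF0
  obtain ⟨g, hg, hg0, hle⟩ := hcov c hc
  obtain ⟨G, hG, hG0, hGg⟩ := exists_mem_degLex_degree_eq hg hg0
  exact ⟨G, hG, hG0, hGg.trans_le hle⟩

end Independence

/-! ### Points whose powers cover a finite set -/

section CoverPoints

theorem coeff_prod_linSeries_mul_prod_geomSeries_eq_zero {R ι : Type*} [CommRing R] [Fintype ι]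
    {A : Finset R} {y : ι → R} (hA : ∀ a ∈ A, ∃ i, y i = a) {d : ℕ}
    (hd : Fintype.card ι < d + A.card) :
    PowerSeries.coeff d ((∏ i, linSeries (y i)) * ∏ a ∈ A, geomSeries a) = 0 := by
  classical
  have hAy : Set.SurjOn y (Finset.univ : Finset ι) A := fun a ha => by
    obtain ⟨i, rfl⟩ := hA a ha
    exact ⟨i, Finset.mem_coe.2 (Finset.mem_univ i), rfl⟩
  obtain ⟨T, -, hinj, rfl⟩ := Finset.exists_subset_injOn_image_eq_of_surjOn _ _ hAy
  rw [Finset.card_image_of_injOn hinj] at hd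
  rw [← Finset.prod_sdiff (Finset.subset_univ T), ← Finset.prod_image (f := linSeries) hinj,
    mul_assoc, prod_linSeries_mul_prod_geomSeries, mul_one, coeff_prod_linSeries_of_card_lt]
  have := T.card_le_univ
  rw [Finset.card_sdiff_of_subset (Finset.subset_univ T), Finset.card_univ]
  omega

theorem coeff_coeff_mul_map_C {σ R : Type*} [CommRing R] {F : PowerSeries (MvPolynomial σ R)}
    {r : ℕ} (hF : ∀ c, (PowerSeries.coeff c F).IsHomogeneous (r * c)) (hr : 0 < r)
    {H : PowerSeries R} (hH : PowerSeries.constantCoeff H = 1) {d : ℕ} {m : σ →₀ ℕ}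
    (hm : r * d ≤ m.degree) :
    coeff m (PowerSeries.coeff d (F * PowerSeries.map C H)) = coeff m (PowerSeries.coeff d F) := by
  rw [PowerSeries.coeff_mul, coeff_sum, Finset.sum_eq_single_of_mem (d, 0)
    (Finset.HasAntidiagonal.mem_antidiagonal.2 (add_zero d))]
  · rw [PowerSeries.coeff_map, PowerSeries.coeff_zero_eq_constantCoeff_apply, hH, map_one, mul_one]
  · rintro ⟨p, q⟩ hpq hne
    have hpq : p + q = d := Finset.HasAntidiagonal.mem_antidiagonal.1 hpq
    have hpd : p < d := by
      rcases Nat.eq_zero_or_pos q with rfl | hq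
      · exact absurd (by rw [← hpq, add_zero]) hne
      · omega
    have hlt : r * p < m.degree := (Nat.mul_lt_mul_of_pos_left hpd hr).trans_le hm
    rw [PowerSeries.coeff_map, mul_comm, coeff_C_mul, (hF p).coeff_eq_zero hlt.ne', mul_zero]

theorem isHomogeneous_coeff_prod_linSeries_X_pow {σ : Type*} [Fintype σ] (R : Type*) [CommRing R]
    (r c : ℕ) :
    (PowerSeries.coeff c (∏ i : σ, linSeries ((X i : MvPolynomial σ R) ^ r))).IsHomogeneous
      (r * c) := by
  have hsign : ((-1 : MvPolynomial σ R) ^ c).IsHomogeneous 0 := by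
    simpa only [map_pow, map_neg, map_one] using isHomogeneous_C σ ((-1 : R) ^ c)
  rw [coeff_prod_linSeries, ← zero_add (r * c)]
  refine hsign.mul (IsHomogeneous.sum _ _ _ fun t ht => ?_)
  have hprod := IsHomogeneous.prod t (fun i => (X i : MvPolynomial σ R) ^ r) (fun _ => 1 * r)
    fun i _ => (isHomogeneous_X R i).pow r
  rwa [Finset.sum_const, (Finset.mem_powersetCard.1 ht).2, smul_eq_mul, one_mul, mul_comm] at hprod

theorem coeff_aeval_X_of_natDegree_le {σ R : Type*} [CommRing R] {p : Polynomial R} (hp : p.Monic)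
    (i : σ) {d : σ →₀ ℕ} (hd : p.natDegree ≤ d.degree) :
    coeff d (Polynomial.aeval (X i : MvPolynomial σ R) p) = coeff d (X i ^ p.natDegree) := by
  classical
  conv_lhs => rw [hp.as_sum]
  simp only [map_add, map_pow, map_sum, map_mul, Polynomial.aeval_X, Polynomial.aeval_C, coeff_add,
    coeff_sum, add_eq_left]
  refine Finset.sum_eq_zero fun e he => ?_
  rw [algebraMap_eq, coeff_C_mul, X_pow_eq_monomial, coeff_monomial, if_neg, mul_zero]
  rintro rfl
  rw [Finsupp.degree_single] at hd
  exact hd.not_gt (Finset.mem_range.1 he)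

variable {n : ℕ} {K : Type*} [Field K]

/-- The points with coordinates in `V` among whose `r`-th powers all elements of `A` occur. -/
def coverPoints (n : ℕ) (A V : Finset K) (r : ℕ) : Set (Fin n → K) :=
  {x | (∀ i, x i ∈ V) ∧ ∀ a ∈ A, ∃ i, x i ^ r = a}

theorem X_pow_card_mem_topFormIdeal (A V : Finset K) (r : ℕ) (i : Fin n) :
    X i ^ V.card ∈ topFormIdeal (vanishingIdeal K (coverPoints n A V r)) := by
  let p : Polynomial K := ∏ v ∈ V, (Polynomial.X - Polynomial.C v)
  have hp : p.Monic := Polynomial.monic_prod_of_monic _ _ fun v _ => Polynomial.monic_X_sub_C v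
  have hdeg : p.natDegree = V.card := Polynomial.natDegree_finsetProd_X_sub_C_eq_card V id
  have hmem : Polynomial.aeval (X i : MvPolynomial (Fin n) K) p
      ∈ vanishingIdeal K (coverPoints n A V r) := by
    intro x hx
    rw [← Polynomial.aeval_algHom_apply, aeval_X, Polynomial.coe_aeval_eq_eval,
      Polynomial.eval_prod]
    exact Finset.prod_eq_zero (hx.1 i) (by simp)
  rw [← hdeg]
  refine mem_topFormIdeal_of_isHomogeneous ?_ hmem fun d => coeff_aeval_X_of_natDegree_le hp i
  simpa only [one_mul] using (isHomogeneous_X K i).pow p.natDegree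

/-- On `coverPoints n A V r` the series `∏ i, (1 - x_i ^ r t)` is divisible by the product of the
`1 - a t` over `A`, so the quotient is a polynomial in `t` of degree at most `n - #A`. -/
theorem coeff_prod_linSeries_X_pow_mem_topFormIdeal (A V : Finset K) {r : ℕ} (hr : 0 < r) {d : ℕ}
    (hd : n < d + A.card) :
    PowerSeries.coeff d (∏ i : Fin n, linSeries ((X i : MvPolynomial (Fin n) K) ^ r))
      ∈ topFormIdeal (vanishingIdeal K (coverPoints n A V r)) := by
  let L := ∏ i : Fin n, linSeries ((X i : MvPolynomial (Fin n) K) ^ r)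
  let H : PowerSeries K := ∏ a ∈ A, geomSeries a
  have hH : PowerSeries.constantCoeff H = 1 := by
    rw [map_prod]
    exact Finset.prod_eq_one fun a _ => constantCoeff_geomSeries a
  have hmem : PowerSeries.coeff d (L * PowerSeries.map C H)
      ∈ vanishingIdeal K (coverPoints n A V r) := by
    intro x hx
    have hL : PowerSeries.map (eval x) L = ∏ i, linSeries (x i ^ r) := by
      rw [map_prod]
      exact Finset.prod_congr rfl fun i _ => by rw [map_linSeries, map_pow, eval_X]
    have hC : PowerSeries.map (eval x) (PowerSeries.map C H) = H := by
      ext c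
      rw [PowerSeries.coeff_map, PowerSeries.coeff_map, eval_C]
    change eval x _ = 0
    rw [← PowerSeries.coeff_map, map_mul, hL, hC]
    exact coeff_prod_linSeries_mul_prod_geomSeries_eq_zero hx.2 (by rwa [Fintype.card_fin])
  exact mem_topFormIdeal_of_isHomogeneous (isHomogeneous_coeff_prod_linSeries_X_pow K r d) hmem
    fun m => coeff_coeff_mul_map_C (isHomogeneous_coeff_prod_linSeries_X_pow K r) hr hH

theorem esymmPow_eq (n r d : ℕ) : esymmPow n r d = (-1) ^ d *
    PowerSeries.coeff d (∏ i : Fin n, linSeries ((X i : MvPolynomial (Fin n) ℂ) ^ r)) := by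
  rw [coeff_prod_linSeries, ← mul_assoc, ← mul_pow, neg_one_mul, neg_neg, one_pow, one_mul,
    esymmPow, esymm, map_sum]
  refine Finset.sum_congr rfl fun t _ => ?_
  rw [map_prod]
  exact Finset.prod_congr rfl fun i _ => by rw [aeval_X]

theorem esymmPow_mem_topFormIdeal (A V : Finset ℂ) {r : ℕ} (hr : 0 < r) {d : ℕ}
    (hd : n < d + A.card) :
    esymmPow n r d ∈ topFormIdeal (vanishingIdeal ℂ (coverPoints n A V r)) := by
  rw [esymmPow_eq]
  exact Ideal.mul_mem_left _ _ (coeff_prod_linSeries_X_pow_mem_topFormIdeal A V hr hd)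

end CoverPoints

section PowerFibers

variable {K : Type*} [Field K] [IsAlgClosed K] [DecidableEq K]

theorem exists_powerFibers (k : ℕ) {r : ℕ} (hr : 0 < r) {ζ : K} (hζ : IsPrimitiveRoot ζ r) :
    ∃ A V : Finset K, A.card = k ∧ V.card = k * r ∧ 0 ∉ V ∧
      ∀ a ∈ A, r ≤ (V.filter fun v => v ^ r = a).card := by
  obtain ⟨A, hA0, hA⟩ := (Set.finite_singleton (0 : K)).infinite_compl.exists_subset_card_eq k
  let roots : K → Finset K := fun a => (Polynomial.nthRoots r a).toFinset
  have mem_roots (a v : K) : v ∈ roots a ↔ v ^ r = a := by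
    rw [Multiset.mem_toFinset, Polynomial.mem_nthRoots hr]
  have card_roots : ∀ a ∈ A, (roots a).card = r := fun a ha => by
    rw [Multiset.toFinset_card_of_nodup (hζ.nthRoots_nodup (hA0 ha)), hζ.card_nthRoots,
      if_pos (IsAlgClosed.exists_pow_nat_eq a hr)]
  refine ⟨A, A.biUnion roots, hA, ?_, fun h => ?_, fun a ha => ?_⟩
  · rw [Finset.card_biUnion, Finset.sum_const_nat card_roots, hA]
    intro a _ b _ hab
    exact Finset.disjoint_left.2 fun v hva hvb =>
      hab (((mem_roots a v).1 hva).symm.trans ((mem_roots b v).1 hvb))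
  · obtain ⟨a, ha, h0⟩ := Finset.mem_biUnion.1 h
    rw [mem_roots, zero_pow hr.ne'] at h0
    exact hA0 ha h0.symm
  · exact (card_roots a ha).ge.trans <| Finset.card_le_card fun v hv =>
      Finset.mem_filter.2 ⟨Finset.mem_biUnion.2 ⟨a, ha, hv⟩, (mem_roots a v).1 hv⟩

theorem exists_powerFibers_add (k : ℕ) {r e : ℕ} (hr : 0 < r) (he : e ≤ 1) {ζ : K}
    (hζ : IsPrimitiveRoot ζ r) :
    ∃ A V : Finset K, A.card = k ∧ V.card = k * r + e ∧
      ∀ a ∈ A, r ≤ (V.filter fun v => v ^ r = a).card := by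
  obtain ⟨A, V, hA, hV, hV0, hfiber⟩ := exists_powerFibers k hr hζ
  rcases Nat.le_one_iff_eq_zero_or_eq_one.1 he with rfl | rfl
  · exact ⟨A, V, hA, hV, hfiber⟩
  · refine ⟨A, insert 0 V, hA, by rw [Finset.card_insert_of_notMem hV0, hV], fun a ha => ?_⟩
    exact (hfiber a ha).trans
      (Finset.card_le_card (Finset.filter_subset_filter _ (Finset.subset_insert 0 V)))

end PowerFibers

/-! ### Skip compositions -/

section SkipComposition

variable {n : ℕ} {S T : Finset (Fin n)} {i j p q : Fin n}

theorem card_filter_lt_le (S : Finset (Fin n)) (i : Fin n) : (S.filter (· < i)).card ≤ i := by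
  rw [← Fin.card_Iio i]
  exact Finset.card_le_card fun j hj => Finset.mem_Iio.2 (Finset.mem_filter.1 hj).2

theorem skipComposition_of_mem (hi : i ∈ S) :
    skipComposition S i = (i : ℕ) + 1 - (S.filter (· < i)).card := if_pos hi

theorem skipComposition_of_notMem (hi : i ∉ S) : skipComposition S i = 0 := if_neg hi

theorem skipComposition_add_card_filter_lt (hi : i ∈ S) :
    skipComposition S i + (S.filter (· < i)).card = i + 1 := by
  have := card_filter_lt_le S i
  rw [skipComposition_of_mem hi]
  omega

theorem skipComposition_pos (hi : i ∈ S) : 0 < skipComposition S i := by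
  have := card_filter_lt_le S i
  have := skipComposition_add_card_filter_lt hi
  omega

theorem mem_of_skipComposition_ne_zero (hi : skipComposition S i ≠ 0) : i ∈ S := by
  by_contra h
  exact hi (skipComposition_of_notMem h)

theorem skipComposition_congr (h : ∀ l ≤ i, (l ∈ S ↔ l ∈ T)) :
    skipComposition S i = skipComposition T i := by
  have hfilter : S.filter (· < i) = T.filter (· < i) := by
    ext l
    simp only [Finset.mem_filter]
    exact and_congr_left fun hl => h l hl.le
  rw [skipComposition, skipComposition, hfilter]
  simp only [h i le_rfl]

theorem card_filter_lt_add_le (S : Finset (Fin n)) (hij : i ≤ j) :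
    (S.filter (· < j)).card + i ≤ (S.filter (· < i)).card + j := by
  have hsub : S.filter (· < j) ⊆ S.filter (· < i) ∪ Finset.Ico i j := by
    intro l hl
    simp only [Finset.mem_filter, Finset.mem_union, Finset.mem_Ico] at hl ⊢
    exact (lt_or_ge l i).imp (fun h => ⟨hl.1, h⟩) fun h => ⟨h, hl.2⟩
  have hcard := (Finset.card_le_card hsub).trans (Finset.card_union_le _ _)
  rw [Fin.card_Ico] at hcard
  rw [Fin.le_def] at hij
  omega

theorem card_filter_lt_lt_card_filter_lt (hi : i ∈ S) (hij : i < j) :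
    (S.filter (· < i)).card < (S.filter (· < j)).card := by
  refine Finset.card_lt_card (Finset.ssubset_iff_of_subset ?_ |>.2 ⟨i, ?_, ?_⟩)
  · exact Finset.monotone_filter_right S fun _ _ hl => hl.trans hij
  · exact Finset.mem_filter.2 ⟨hi, hij⟩
  · exact fun h => (Finset.mem_filter.1 h).2.false

theorem skipComposition_le_skipComposition (hij : i ≤ j) (hj : j ∈ S) :
    skipComposition S i ≤ skipComposition S j := by
  by_cases hi : i ∈ S
  · have := card_filter_lt_add_le S hij
    have := skipComposition_add_card_filter_lt hi
    have := skipComposition_add_card_filter_lt hj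
    omega
  · exact (skipComposition_of_notMem hi).trans_le (Nat.zero_le _)

theorem nonzeroAntitone_skipComposition_rev (S : Finset (Fin n)) :
    NonzeroAntitone fun i : Fin n => skipComposition S i.rev := fun _ _ hpq hp =>
  skipComposition_le_skipComposition (Fin.rev_le_rev.2 hpq.le) (mem_of_skipComposition_ne_zero hp)

theorem skipComposition_add_card_le (hi : i ∈ S) {N : ℕ} (hN : ∀ j ∈ S, (j : ℕ) < N) :
    skipComposition S i + S.card ≤ N + 1 := by
  have hge : (S.filter (¬ · < i)).card ≤ N - i := by
    rw [← Nat.card_Ico, ← Finset.card_map Fin.valEmbedding]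
    refine Finset.card_le_card fun l hl => ?_
    obtain ⟨j, hj, rfl⟩ := Finset.mem_map.1 hl
    obtain ⟨hjS, hij⟩ := Finset.mem_filter.1 hj
    exact Finset.mem_Ico.2 ⟨not_lt.1 hij, hN j hjS⟩
  have := S.card_filter_add_card_filter_not (· < i)
  have := skipComposition_add_card_filter_lt hi
  have := hN i hi
  omega

theorem card_filter_lt_succ_map_succEmb (S : Finset (Fin n)) (j : Fin n) :
    ((S.map (Fin.succEmb n)).filter (· < j.succ)).card = (S.filter (· < j)).card := by
  rw [Finset.filter_map, Finset.card_map]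
  exact congrArg Finset.card (Finset.filter_congr fun l _ => Fin.succ_lt_succ_iff)

theorem zero_notMem_map_succEmb (S : Finset (Fin n)) : 0 ∉ S.map (Fin.succEmb n) := fun h => by
  obtain ⟨j, -, hj⟩ := Finset.mem_map.1 h
  exact Fin.succ_ne_zero j hj

theorem skipComposition_map_succEmb (hj : j ∈ S) :
    skipComposition (S.map (Fin.succEmb n)) j.succ = skipComposition S j + 1 := by
  have h := skipComposition_add_card_filter_lt (Finset.mem_map_of_mem (Fin.succEmb n) hj)
  rw [Fin.coe_succEmb, card_filter_lt_succ_map_succEmb, Fin.val_succ] at h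
  have := skipComposition_add_card_filter_lt hj
  omega

theorem skipComposition_insert_zero_map_succEmb (hj : j ∈ S) :
    skipComposition (insert 0 (S.map (Fin.succEmb n))) j.succ = skipComposition S j := by
  have h := skipComposition_add_card_filter_lt
    (Finset.mem_insert_of_mem (a := j.succ) (b := 0) (Finset.mem_map_of_mem (Fin.succEmb n) hj))
  rw [Finset.filter_insert, if_pos (Fin.succ_pos j), Finset.card_insert_of_notMem fun h0 =>
    zero_notMem_map_succEmb S (Finset.mem_filter.1 h0).1, card_filter_lt_succ_map_succEmb,
    Fin.val_succ] at h
  have := skipComposition_add_card_filter_lt hj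
  omega

theorem exists_skipComposition_le_of_not_isStandard {k r n u : ℕ} (hu : u ≤ k) {d : Fin n → ℕ}
    (h : ¬ IsStandard k r n u d) : ∃ S : Finset (Fin n), S.card = n + 1 - u ∧
      ∀ i ∈ S, (skipComposition S i + (k - u)) * r ≤ d i := by
  induction n generalizing u with
  | zero =>
    exact ⟨∅, by rw [Finset.card_empty]; have : u ≠ 0 := h; omega, fun _ hi => by simp at hi⟩
  | succ n ih =>
    by_cases hun : n + 2 ≤ u
    · exact ⟨∅, by rw [Finset.card_empty]; omega, fun _ hi => by simp at hi⟩
    rw [IsStandard] at h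
    split_ifs at h with h0
    · obtain ⟨S, hS, hle⟩ := ih hu h
      refine ⟨insert 0 (S.map (Fin.succEmb n)), ?_, fun i hi => ?_⟩
      · rw [Finset.card_insert_of_notMem (zero_notMem_map_succEmb S), Finset.card_map]
        omega
      · rcases Finset.mem_insert.1 hi with rfl | hi
        · refine le_trans (Nat.mul_le_mul_right _ ?_) h0
          rw [skipComposition_of_mem (Finset.mem_insert_self _ _), Fin.val_zero]
          omega
        · obtain ⟨j, hj, rfl⟩ := Finset.mem_map.1 hi
          rw [Fin.coe_succEmb, skipComposition_insert_zero_map_succEmb hj]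
          exact hle j hj
    · obtain ⟨S, hS, hle⟩ := ih (u := u - 1) (by omega) h
      have hcard : S.card ≤ n := card_finset_fin_le S
      refine ⟨S.map (Fin.succEmb n), by rw [Finset.card_map]; omega, fun i hi => ?_⟩
      obtain ⟨j, hj, rfl⟩ := Finset.mem_map.1 hi
      rw [Fin.coe_succEmb, skipComposition_map_succEmb hj]
      exact le_trans (Nat.mul_le_mul_right _ (by omega)) (hle j hj)

theorem exists_first_ne {α : Type*} [LinearOrder α] {S T : Finset α} (hne : S ≠ T) :
    ∃ p, (p ∈ S ∧ p ∉ T ∨ p ∈ T ∧ p ∉ S) ∧ ∀ l < p, (l ∈ S ↔ l ∈ T) := by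
  have h : (symmDiff S T).Nonempty := Finset.nonempty_iff_ne_empty.2 fun h =>
    hne (symmDiff_eq_bot.1 h)
  refine ⟨(symmDiff S T).min' h, Finset.mem_symmDiff.1 (Finset.min'_mem _ h), fun l hl => ?_⟩
  have hl' : l ∉ symmDiff S T := fun h' => hl.not_ge (Finset.min'_le _ _ h')
  rw [Finset.mem_symmDiff] at hl'
  tauto

theorem exists_mem_filter_lt_eq {α : Type*} [LinearOrder α] {S T : Finset α} {p : α}
    (hcard : S.card = T.card) (hpS : p ∉ S) (hpT : p ∈ T) (hlt : ∀ l < p, (l ∈ S ↔ l ∈ T)) :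
    ∃ q ∈ S, p < q ∧ S.filter (· < q) = T.filter (· < p) := by
  have hfilter : S.filter (· < p) = T.filter (· < p) := by
    ext l
    simp only [Finset.mem_filter]
    exact and_congr_left fun hl => hlt l hl
  have hne : (S.filter (p < ·)).Nonempty := by
    by_contra hempty
    have hSp : S ⊆ T.filter (· < p) := fun l hl => hfilter ▸ Finset.mem_filter.2 ⟨hl, by
      by_contra hpl
      exact hempty ⟨l, Finset.mem_filter.2 ⟨hl, lt_of_le_of_ne (not_lt.1 hpl) fun h =>
        hpS (h ▸ hl)⟩⟩⟩
    have hTp : T.filter (· < p) ⊂ T := Finset.filter_ssubset.2 ⟨p, hpT, lt_irrefl p⟩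
    exact ((Finset.card_le_card hSp).trans_lt (Finset.card_lt_card hTp)).ne hcard
  obtain ⟨hqS, hpq⟩ := Finset.mem_filter.1 (Finset.min'_mem _ hne)
  refine ⟨_, hqS, hpq, hfilter ▸ Finset.filter_congr fun l hl => ⟨fun hlq => ?_, (·.trans hpq)⟩⟩
  by_contra hpl
  exact hlq.not_ge (Finset.min'_le _ _
    (Finset.mem_filter.2 ⟨hl, lt_of_le_of_ne (not_lt.1 hpl) fun h => hpS (h ▸ hl)⟩))

theorem skipComposition_add_card_filter_lt_le (hp : p ∈ T) (hpq : p < q) (hjq : j ≤ q) :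
    skipComposition T j + (T.filter (· < p)).card ≤ q := by
  rw [Fin.lt_def] at hpq
  have hp' := skipComposition_add_card_filter_lt hp
  rcases le_or_gt j p with hjp | hpj
  · have := skipComposition_le_skipComposition hjp hp
    omega
  · by_cases hj : j ∈ T
    · have := card_filter_lt_lt_card_filter_lt hp hpj
      have := skipComposition_add_card_filter_lt hj
      rw [Fin.le_def] at hjq
      omega
    · rw [skipComposition_of_notMem hj]
      omega

theorem sum_skipComposition_lt_of_first_ne (hpS : p ∈ S) (hpT : p ∉ T)
    (hlt : ∀ l < p, (l ∈ S ↔ l ∈ T)) :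
    ∑ i ∈ Finset.Iic p, skipComposition T i < ∑ i ∈ Finset.Iic p, skipComposition S i := by
  refine Finset.sum_lt_sum (fun i hi => ?_) ⟨p, Finset.mem_Iic.2 le_rfl, ?_⟩
  · rcases (Finset.mem_Iic.1 hi).eq_or_lt with rfl | hip
    · exact (skipComposition_of_notMem hpT).trans_le (Nat.zero_le _)
    · exact (skipComposition_congr fun l hl => (hlt l (hl.trans_lt hip)).symm).le
  · rw [skipComposition_of_notMem hpT]
    exact skipComposition_pos hpS

theorem exists_lt_skipComposition {d : Fin n → ℕ} (hcard : S.card = T.card) (hne : S ≠ T)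
    (hsum : ∀ i, ∑ p ∈ Finset.Iic i, d p ≤ ∑ p ∈ Finset.Iic i, skipComposition T p)
    (hsup : ∀ i, d i ≤ (Finset.Iic i).sup (skipComposition T)) :
    ∃ i, d i < skipComposition S i := by
  by_contra! hle
  obtain ⟨p, ⟨hpS, hpT⟩ | ⟨hpT, hpS⟩, hlt⟩ := exists_first_ne hne
  · exact (sum_skipComposition_lt_of_first_ne hpS hpT hlt).not_ge
      ((Finset.sum_le_sum fun i _ => hle i).trans (hsum p))
  · obtain ⟨q, hqS, hpq, hfilter⟩ := exists_mem_filter_lt_eq hcard hpS hpT hlt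
    obtain ⟨j, hj, hsupj⟩ := Finset.exists_mem_eq_sup (Finset.Iic q) ⟨q, Finset.mem_Iic.2 le_rfl⟩
      (skipComposition T)
    have hS := skipComposition_add_card_filter_lt hqS
    have hT := skipComposition_add_card_filter_lt_le hpT hpq (Finset.mem_Iic.1 hj)
    have hST := (hle q).trans ((hsup q).trans_eq hsupj)
    rw [hfilter] at hS
    omega

end SkipComposition

/-! ### Skip Demazure characters -/

section SkipDemazure

theorem toLex_le_of_sum_le {σ : Type*} [LinearOrder σ] [LocallyFiniteOrderBot σ] {d e : σ →₀ ℕ}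
    (h : ∀ i, ∑ p ∈ Finset.Iic i, d p ≤ ∑ p ∈ Finset.Iic i, e p) : toLex d ≤ toLex e := by
  by_contra hlt
  rw [not_le, Finsupp.Lex.lt_iff] at hlt
  obtain ⟨i, hbelow, hi⟩ := hlt
  refine (h i).not_gt (Finset.sum_lt_sum (fun p hp => ?_) ⟨i, Finset.mem_Iic.2 le_rfl, hi⟩)
  rcases (Finset.mem_Iic.1 hp).eq_or_lt with rfl | hpi
  · exact hi.le
  · exact (hbelow p hpi).le

variable {n : ℕ}

theorem Iic_eq_map_revPerm (i : Fin n) :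
    Finset.Iic i = (Finset.Ici i.rev).map Fin.revPerm.toEmbedding := by
  rw [Fin.map_revPerm_Ici, Fin.rev_rev]

theorem reversePow_eq_expand (r : ℕ) (f : MvPolynomial (Fin n) ℂ) :
    reversePow r f = expand r (rename Fin.revPerm f) := by
  have hcomp : (aeval fun i : Fin n => (X i.rev : MvPolynomial (Fin n) ℂ) ^ r)
      = (expand r).comp (rename Fin.revPerm) :=
    algHom_ext fun i => by rw [aeval_X, AlgHom.comp_apply, rename_X, expand_X, Fin.revPerm_apply]
  rw [reversePow, hcomp, AlgHom.comp_apply]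

theorem reversePow_esymm (r d : ℕ) : reversePow r (esymm (Fin n) ℂ d) = esymmPow n r d := by
  rw [reversePow_eq_expand, rename_esymm]
  rfl

/-- The skip composition `γ(S)` as the exponent of a monomial. -/
def skipExponent (S : Finset (Fin n)) : Fin n →₀ ℕ :=
  Finsupp.equivFunOnFinite.symm (skipComposition S)

theorem coeff_skipDemazure {r : ℕ} (hr : r ≠ 0) (S : Finset (Fin n)) :
    coeff (r • skipExponent S) (skipDemazure r S) = 1 := by
  have hrev : skipExponent S = Finsupp.mapDomain Fin.revPerm
      (Finsupp.equivFunOnFinite.symm fun i => skipComposition S i.rev) := by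
    ext i
    rw [Finsupp.mapDomain_equiv_apply, Fin.revPerm_symm, Fin.revPerm_apply]
    exact congrArg (skipComposition S) (Fin.rev_rev i).symm
  rw [skipDemazure, reversePow_eq_expand, hrev, coeff_expand_smul r hr,
    coeff_rename_mapDomain _ Fin.revPerm.injective,
    coeff_demazureChar_self (nonzeroAntitone_skipComposition_rev S)]

theorem exists_eq_smul_of_mem_support_skipDemazure {r : ℕ} {S : Finset (Fin n)} {d : Fin n →₀ ℕ}
    (hd : d ∈ (skipDemazure r S).support) :
    ∃ c : Fin n →₀ ℕ, d = r • c ∧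
      (∀ i, ∑ p ∈ Finset.Iic i, c p ≤ ∑ p ∈ Finset.Iic i, skipComposition S p) ∧
      ∀ i, c i ≤ (Finset.Iic i).sup (skipComposition S) := by
  classical
  rw [skipDemazure, reversePow_eq_expand] at hd
  obtain ⟨c, hc, rfl⟩ := Finset.mem_image.1 (support_expand_subset _ hd)
  rw [support_rename_of_injective Fin.revPerm.injective] at hc
  obtain ⟨b, hb, rfl⟩ := Finset.mem_image.1 hc
  have hγ := nonzeroAntitone_skipComposition_rev S
  have hrev (i : Fin n) : Finsupp.mapDomain Fin.revPerm b i = b i.rev := by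
    rw [Finsupp.mapDomain_equiv_apply, Fin.revPerm_symm, Fin.revPerm_apply]
  refine ⟨_, rfl, fun i => ?_, fun i => ?_⟩
  · rw [Iic_eq_map_revPerm, Finset.sum_map, Finset.sum_map]
    simp only [hrev, Equiv.coe_toEmbedding, Fin.revPerm_apply, Fin.rev_rev]
    exact sum_le_of_mem_support_demazureChar hγ hb i.rev
  · rw [Iic_eq_map_revPerm, Finset.sup_map, hrev]
    exact apply_le_sup_of_mem_support_demazureChar hγ hb i.rev

theorem lex_degree_skipDemazure {r : ℕ} (hr : r ≠ 0) (S : Finset (Fin n)) :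
    MonomialOrder.lex.degree (skipDemazure r S) = r • skipExponent S := by
  apply MonomialOrder.lex.toSyn.injective
  apply le_antisymm
  · rw [MonomialOrder.degree_le_iff]
    intro d hd
    obtain ⟨c, rfl, hsum, -⟩ := exists_eq_smul_of_mem_support_skipDemazure hd
    rw [MonomialOrder.lex_le_iff]
    refine toLex_le_of_sum_le fun i => ?_
    simp only [Finsupp.smul_apply, smul_eq_mul, ← Finset.mul_sum]
    exact Nat.mul_le_mul_left r (hsum i)
  · apply MonomialOrder.le_degree
    rw [mem_support_iff, coeff_skipDemazure hr]
    exact one_ne_zero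

theorem monic_skipDemazure {r : ℕ} (hr : r ≠ 0) (S : Finset (Fin n)) :
    MonomialOrder.lex.Monic (skipDemazure r S) := by
  rw [MonomialOrder.Monic, MonomialOrder.leadingCoeff, lex_degree_skipDemazure hr,
    coeff_skipDemazure hr]

theorem card_filter_lt_rev_le {m : ℕ} {S : Finset (Fin n)} {b : Fin (m + 1) → Fin n}
    (hb : StrictMono b) (hrange : ∀ p, p.rev ∈ S → p ∈ Set.range b) (j : Fin (m + 1)) :
    (S.filter (· < (b j).rev)).card + j ≤ m := by
  have hsub : S.filter (· < (b j).rev) ⊆ (Finset.Ioi j).image (Fin.rev ∘ b) := by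
    intro s hs
    obtain ⟨hsS, hlt⟩ := Finset.mem_filter.1 hs
    obtain ⟨l, hl⟩ := hrange s.rev (by rwa [Fin.rev_rev])
    refine Finset.mem_image.2 ⟨l, ?_, by rw [Function.comp_apply, hl, Fin.rev_rev]⟩
    rw [Finset.mem_Ioi, ← hb.lt_iff_lt, hl, ← Fin.rev_lt_rev, Fin.rev_rev]
    exact hlt
  have hcard := (Finset.card_le_card hsub).trans Finset.card_image_le
  rw [Fin.card_Ioi] at hcard
  omega

theorem skipDemazure_mem (r : ℕ) {S : Finset (Fin n)} (hS : S.Nonempty)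
    {I : Ideal (MvPolynomial (Fin n) ℂ)} (hI : ∀ d, S.card ≤ d → d ≤ n → esymmPow n r d ∈ I) :
    skipDemazure r S ∈ I := by
  obtain ⟨m, hm⟩ := Nat.exists_eq_add_one_of_ne_zero hS.card_pos.ne'
  let b := (S.map Fin.revPerm.toEmbedding).orderEmbOfFin ((Finset.card_map _).trans hm)
  have hrange (p : Fin n) : p.rev ∈ S ↔ p ∈ Set.range b := by
    rw [Finset.range_orderEmbOfFin, Finset.mem_coe, Finset.mem_map_equiv, Fin.revPerm_symm,
      Fin.revPerm_apply]
  have hparts (p : Fin n) : skipComposition S p.rev ≠ 0 ↔ p ∈ Set.range b :=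
    ⟨fun h => (hrange p).1 (mem_of_skipComposition_ne_zero h),
      fun h => (skipComposition_pos ((hrange p).2 h)).ne'⟩
  have hmem : demazureChar (fun i : Fin n => skipComposition S i.rev) ∈
      I.comap (aeval fun i : Fin n => (X i.rev : MvPolynomial (Fin n) ℂ) ^ r) := by
    rw [demazureChar_eq_det_jacobiTrudi (nonzeroAntitone_skipComposition_rev S) b.strictMono hparts]
    refine det_jacobiTrudi_mem b _ (fun j => ?_) fun d hmd hdn => ?_
    · have hskip := skipComposition_add_card_filter_lt ((hrange _).2 ⟨j, rfl⟩)
      have hcard := card_filter_lt_rev_le b.strictMono (fun p => (hrange p).1) j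
      rw [Fin.val_rev] at hskip
      have := (b j).isLt
      rw [Function.comp_apply]
      omega
    · rw [Ideal.mem_comap, ← reversePow, reversePow_esymm]
      exact hI d (by omega) hdn
  exact hmem

end SkipDemazure

/-! ### The Gröbner bases -/

section GroebnerBasis

theorem isGroebnerBasis_of_forall_exists_degree_le {σ R : Type*} [CommRing R] [Nontrivial R]
    {m : MonomialOrder σ} {I : Ideal (MvPolynomial σ R)} {B : Set (MvPolynomial σ R)}
    (hfin : B.Finite) (hBI : B ⊆ I) (hunit : ∀ g ∈ B, IsUnit (m.leadingCoeff g))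
    (hdiv : ∀ f ∈ I, f ≠ 0 → ∃ g ∈ B, m.degree g ≤ m.degree f) : IsGroebnerBasis m B I := by
  have hne : ∀ g ∈ B, g ≠ 0 := fun g hg => m.leadingCoeff_ne_zero_iff.1 (hunit g hg).ne_zero
  refine ⟨hfin, fun g hg => ⟨hBI hg, hne g hg⟩, le_antisymm (Ideal.span_le.2 ?_)
    (Ideal.span_mono ?_)⟩
  · rintro t ⟨f, hf, hf0, rfl⟩
    obtain ⟨g, hg, hgf⟩ := hdiv f hf hf0
    obtain ⟨c, hc⟩ := exists_add_of_le hgf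
    obtain ⟨u, hu⟩ := (hunit g hg).exists_left_inv
    have hmul : m.leadingTerm f = monomial c (m.leadingCoeff f * u) * m.leadingTerm g := by
      rw [MonomialOrder.leadingTerm, MonomialOrder.leadingTerm, monomial_mul, mul_assoc, hu,
        mul_one, hc, add_comm]
    rw [hmul]
    exact Ideal.mul_mem_left _ _ (Ideal.subset_span ⟨g, hg, rfl⟩)
  · rintro t ⟨g, hg, rfl⟩
    exact ⟨g, hBI hg, hne g hg, rfl⟩

theorem degree_X_pow {σ R : Type*} [CommRing R] [Nontrivial R] (m : MonomialOrder σ) (i : σ)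
    (a : ℕ) : m.degree (X i ^ a : MvPolynomial σ R) = Finsupp.single i a := by
  classical
  rw [X_pow_eq_monomial, MonomialOrder.degree_monomial, if_neg one_ne_zero]

theorem eq_single_of_mem_support_X_pow {σ R : Type*} [CommRing R] {i : σ} {a : ℕ} {d : σ →₀ ℕ}
    (hd : d ∈ (X i ^ a : MvPolynomial σ R).support) : d = Finsupp.single i a := by
  classical
  rw [X_pow_eq_monomial] at hd
  exact Finset.mem_singleton.1 (support_monomial_subset hd)

variable {n : ℕ}

/-- The exponents below `a` in every coordinate that are standard for `k` and `r`; these turn out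
to be the exponents of the standard monomials of `powerIdeal n k r a`. -/
def standardExponents (n k r a : ℕ) : Set (Fin n →₀ ℕ) :=
  {d | (∀ i, d i < a) ∧ IsStandard k r n k d}

/-- The common form of the ideals `I_{n,k}` and `J_{n,k}`, with the exponent of the variable powers
as a parameter `a`. -/
def powerIdeal (n k r a : ℕ) : Ideal (MvPolynomial (Fin n) ℂ) :=
  Ideal.span ({f | ∃ i, f = X i ^ a} ∪ {f | ∃ d, n - k + 1 ≤ d ∧ d ≤ n ∧ f = esymmPow n r d})

/-- The common form of the Gröbner bases of `I_{n,k}` and `J_{n,k}`: the powers `x_i^a` and those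
skip Demazure characters whose leading monomial is divisible by none of these powers. -/
def powerBasis (n k r a : ℕ) : Set (MvPolynomial (Fin n) ℂ) :=
  {f | ∃ i, f = X i ^ a} ∪ {f | ∃ S : Finset (Fin n),
    (∀ i, r * skipComposition S i < a) ∧ S.card = n - k + 1 ∧ f = skipDemazure r S}

theorem finite_powerBasis (n k r a : ℕ) : (powerBasis n k r a).Finite := by
  refine ((Set.finite_range fun i : Fin n => (X i ^ a : MvPolynomial (Fin n) ℂ)).union
    (Set.finite_range fun S : Finset (Fin n) => skipDemazure r S)).subset ?_
  rintro f (⟨i, rfl⟩ | ⟨S, -, -, rfl⟩)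
  · exact Or.inl ⟨i, rfl⟩
  · exact Or.inr ⟨S, rfl⟩

theorem powerBasis_subset_powerIdeal (n k r a : ℕ) :
    powerBasis n k r a ⊆ powerIdeal n k r a := by
  rintro g (⟨i, rfl⟩ | ⟨S, -, hS, rfl⟩)
  · exact Ideal.subset_span (Or.inl ⟨i, rfl⟩)
  · refine skipDemazure_mem r (Finset.card_pos.1 (by omega)) fun d hSd hdn => ?_
    exact Ideal.subset_span (Or.inr ⟨d, hS ▸ hSd, hdn, rfl⟩)

theorem monic_of_mem_powerBasis {k r a : ℕ} (hr : r ≠ 0) {g : MvPolynomial (Fin n) ℂ}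
    (hg : g ∈ powerBasis n k r a) : MonomialOrder.lex.Monic g := by
  rcases hg with ⟨i, rfl⟩ | ⟨S, -, -, rfl⟩
  · exact MonomialOrder.monic_X.pow
  · exact monic_skipDemazure hr S

theorem exists_mem_powerBasis_lex_degree_le {k r a : ℕ} (hkn : k ≤ n) (hr : r ≠ 0)
    {c : Fin n →₀ ℕ} (hc : c ∉ standardExponents n k r a) :
    ∃ g ∈ powerBasis n k r a, MonomialOrder.lex.degree g ≤ c := by
  by_cases hca : ∀ i, c i < a
  · obtain ⟨S, hS, hle⟩ := exists_skipComposition_le_of_not_isStandard le_rfl fun h => hc ⟨hca, h⟩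
    have hSc (i : Fin n) : r * skipComposition S i ≤ c i := by
      by_cases hi : i ∈ S
      · have := hle i hi
        rwa [Nat.sub_self, add_zero, mul_comm] at this
      · rw [skipComposition_of_notMem hi, mul_zero]
        exact Nat.zero_le _
    refine ⟨_, Or.inr ⟨S, fun i => (hSc i).trans_lt (hca i), by omega, rfl⟩, ?_⟩
    rw [lex_degree_skipDemazure hr]
    exact hSc
  · push Not at hca
    obtain ⟨i, hi⟩ := hca
    exact ⟨_, Or.inl ⟨i, rfl⟩, (degree_X_pow _ i a).trans_le (Finsupp.single_le_iff.2 hi)⟩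

theorem powerIdeal_le_topFormIdeal (n : ℕ) (A V : Finset ℂ) {r : ℕ} (hr : 0 < r) :
    powerIdeal n A.card r V.card ≤ topFormIdeal (vanishingIdeal ℂ (coverPoints n A V r)) := by
  refine Ideal.span_le.2 ?_
  rintro f (⟨i, rfl⟩ | ⟨d, hd, -, rfl⟩)
  · exact X_pow_card_mem_topFormIdeal A V r i
  · exact esymmPow_mem_topFormIdeal A V hr (by omega)

theorem eq_zero_of_mem_vanishingIdeal_coverPoints {K : Type*} [Field K] [DecidableEq K]
    {A V : Finset K} {r : ℕ} (hV : ∀ a ∈ A, r ≤ (V.filter fun v => v ^ r = a).card)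
    {F : MvPolynomial (Fin n) K} (hF : F ∈ vanishingIdeal K (coverPoints n A V r))
    (hsupp : ↑F.support ⊆ standardExponents n A.card r V.card) : F = 0 := by
  refine eq_zero_of_isStandard_of_eval_eq_zero hV (fun d hd => hsupp hd) fun x hx hcard => ?_
  have hhit := Finset.eq_of_subset_of_card_le (hit_subset A ((· ^ r) ∘ x)) hcard
  refine hF x ⟨hx, fun a ha => ?_⟩
  rw [← hhit] at ha
  exact (Finset.mem_filter.1 ha).2

theorem isGroebnerBasis_powerBasis {k r e : ℕ} (hkn : k ≤ n) (hr : 0 < r) (he : e ≤ 1) :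
    IsGroebnerBasis MonomialOrder.lex (powerBasis n k r (k * r + e))
      (powerIdeal n k r (k * r + e)) := by
  classical
  obtain ⟨A, V, rfl, hVcard, hV⟩ :=
    exists_powerFibers_add k hr he (Complex.isPrimitiveRoot_exp r hr.ne')
  rw [← hVcard]
  have hmonic (g) (hg : g ∈ powerBasis n A.card r V.card) := monic_of_mem_powerBasis hr.ne' hg
  have hdiv (c) (hc : c ∉ standardExponents n A.card r V.card) :=
    exists_mem_powerBasis_lex_degree_le hkn hr.ne' hc
  have htop := powerIdeal_le_topFormIdeal n A V hr
  refine isGroebnerBasis_of_forall_exists_degree_le (finite_powerBasis _ _ _ _)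
    (powerBasis_subset_powerIdeal _ _ _ _) (fun g hg => (hmonic g hg).symm ▸ isUnit_one)
    fun f hf hf0 => hdiv _ (lex_degree_notMem_of_mem_topFormIdeal
      (fun F => eq_zero_of_mem_vanishingIdeal_coverPoints hV) (fun c hc => ?_) (htop hf) hf0)
  obtain ⟨g, hg, hgc⟩ := hdiv c hc
  exact ⟨g, htop (powerBasis_subset_powerIdeal _ _ _ _ hg), (hmonic g hg).ne_zero, hgc⟩

theorem not_lex_degree_le_of_mem_powerBasis {k r a : ℕ} (hkn : k < n) (hr : 0 < r) (ha : 0 < a)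
    {g h : MvPolynomial (Fin n) ℂ} (hg : g ∈ powerBasis n k r a) (hh : h ∈ powerBasis n k r a)
    (hne : g ≠ h) {d : Fin n →₀ ℕ} (hd : d ∈ h.support) : ¬ MonomialOrder.lex.degree g ≤ d := by
  intro hle
  rcases hg with ⟨i, rfl⟩ | ⟨S, -, hS, rfl⟩ <;> rcases hh with ⟨j, rfl⟩ | ⟨T, hTa, hT, rfl⟩
  · have hij : i ≠ j := fun h => hne (h ▸ rfl)
    rw [degree_X_pow, eq_single_of_mem_support_X_pow hd, Finsupp.single_le_iff,
      Finsupp.single_eq_of_ne hij] at hle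
    exact ha.not_ge hle
  · obtain ⟨c, rfl, -, hsup⟩ := exists_eq_smul_of_mem_support_skipDemazure hd
    rw [degree_X_pow, Finsupp.single_le_iff] at hle
    obtain ⟨p, -, hp⟩ := Finset.exists_mem_eq_sup (Finset.Iic i) ⟨i, Finset.mem_Iic.2 le_rfl⟩
      (skipComposition T)
    exact (hle.trans (Nat.mul_le_mul_left r ((hsup i).trans_eq hp))).not_gt (hTa p)
  · obtain ⟨l, hl, hlj⟩ := Finset.exists_mem_ne (by omega : 1 < S.card) j
    rw [lex_degree_skipDemazure hr.ne', eq_single_of_mem_support_X_pow hd] at hle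
    have hl0 := hle l
    rw [Finsupp.single_eq_of_ne hlj] at hl0
    exact (Nat.mul_pos hr (skipComposition_pos hl)).not_ge hl0
  · obtain ⟨c, rfl, hsum, hsup⟩ := exists_eq_smul_of_mem_support_skipDemazure hd
    rw [lex_degree_skipDemazure hr.ne'] at hle
    obtain ⟨i, hi⟩ := exists_lt_skipComposition (hS.trans hT.symm) (fun h => hne (h ▸ rfl))
      hsum hsup
    exact (Nat.mul_lt_mul_of_pos_left hi hr).not_ge (hle i)

theorem isReducedGroebnerBasis_powerBasis {k r e : ℕ} (hk : 0 < k) (hkn : k < n) (hr : 0 < r)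
    (he : e ≤ 1) : IsReducedGroebnerBasis MonomialOrder.lex (powerBasis n k r (k * r + e))
      (powerIdeal n k r (k * r + e)) :=
  ⟨isGroebnerBasis_powerBasis hkn.le hr he, fun _ hg => monic_of_mem_powerBasis hr.ne' hg,
    fun _ hg _ hh hne _ hd => not_lex_degree_le_of_mem_powerBasis hkn hr
      (Nat.add_pos_left (Nat.mul_pos hk hr) e) hg hh hne hd⟩

theorem mul_skipComposition_le {k : ℕ} (r : ℕ) {S : Finset (Fin n)} (hkn : k ≤ n)
    (hS : S.card = n - k + 1) (i : Fin n) : r * skipComposition S i ≤ k * r := by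
  rw [mul_comm k]
  refine Nat.mul_le_mul_left r ?_
  by_cases hi : i ∈ S
  · have := skipComposition_add_card_le hi fun j _ => j.isLt
    omega
  · exact (skipComposition_of_notMem hi).trans_le (Nat.zero_le k)

theorem forall_mul_skipComposition_lt_iff {k r : ℕ} {S : Finset (Fin n)} (hkn : k ≤ n) (hr : 0 < r)
    (hS : S.card = n - k + 1) :
    (∀ i, r * skipComposition S i < k * r) ↔ ∀ i ∈ S, (i : ℕ) + 1 ≤ n - 1 := by
  have hSn : S.card ≤ n := card_finset_fin_le S
  simp only [mul_comm k, Nat.mul_lt_mul_left hr]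
  constructor
  · intro h i hi
    have hlt := Finset.card_lt_card
      (Finset.filter_ssubset (p := (· < i)).2 ⟨i, hi, lt_irrefl i⟩)
    have := skipComposition_add_card_filter_lt hi
    have := h i
    omega
  · intro h i
    by_cases hi : i ∈ S
    · have := skipComposition_add_card_le hi h
      omega
    · rw [skipComposition_of_notMem hi]
      omega

theorem basisI_eq_powerBasis {k : ℕ} (hkn : k ≤ n) (r : ℕ) :
    basisI n k r = powerBasis n k r (k * r + 1) := by
  refine congrArg _ (Set.ext fun f => exists_congr fun S => ⟨fun ⟨hS, hf⟩ => ⟨fun i => ?_, hS, hf⟩,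
    And.right⟩)
  exact Nat.lt_succ_of_le (mul_skipComposition_le r hkn hS i)

theorem basisJ_eq_powerBasis {k r : ℕ} (hkn : k ≤ n) (hr : 0 < r) :
    basisJ n k r = powerBasis n k r (k * r) :=
  congrArg _ (Set.ext fun _ => exists_congr fun _ => and_congr_left fun ⟨hS, _⟩ =>
    (forall_mul_skipComposition_lt_iff hkn hr hS).symm)

end GroebnerBasis

end SkipGroebner

end

theorem mainTheorem6_general (n k r : ℕ) (hkn : k ≤ n) (hr : 0 < r) :
    (SkipGroebner.IsGroebnerBasis MonomialOrder.lex
        (SkipGroebner.basisI n k r) (SkipGroebner.idealI n k r) ∧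
      (0 < k → k < n → SkipGroebner.IsReducedGroebnerBasis MonomialOrder.lex
        (SkipGroebner.basisI n k r) (SkipGroebner.idealI n k r))) ∧
    (SkipGroebner.IsGroebnerBasis MonomialOrder.lex
        (SkipGroebner.basisJ n k r) (SkipGroebner.idealJ n k r) ∧
      (0 < k → k < n → SkipGroebner.IsReducedGroebnerBasis MonomialOrder.lex
        (SkipGroebner.basisJ n k r) (SkipGroebner.idealJ n k r))) := by
  rw [SkipGroebner.basisI_eq_powerBasis hkn, SkipGroebner.basisJ_eq_powerBasis hkn hr]
  exact ⟨⟨SkipGroebner.isGroebnerBasis_powerBasis hkn hr le_rfl,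
      fun hk hlt => SkipGroebner.isReducedGroebnerBasis_powerBasis hk hlt hr le_rfl⟩,
    SkipGroebner.isGroebnerBasis_powerBasis hkn hr zero_le_one,
      fun hk hlt => SkipGroebner.isReducedGroebnerBasis_powerBasis hk hlt hr zero_le_one⟩

theorem mainTheorem6 (n k r : ℕ) (hn : 1 ≤ n) (hkn : k ≤ n) (hr : 2 ≤ r) :
    (SkipGroebner.IsGroebnerBasis MonomialOrder.lex
        (SkipGroebner.basisI n k r) (SkipGroebner.idealI n k r) ∧
      (0 < k → k < n → SkipGroebner.IsReducedGroebnerBasis MonomialOrder.lex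
        (SkipGroebner.basisI n k r) (SkipGroebner.idealI n k r))) ∧
    (SkipGroebner.IsGroebnerBasis MonomialOrder.lex
        (SkipGroebner.basisJ n k r) (SkipGroebner.idealJ n k r) ∧
      (0 < k → k < n → SkipGroebner.IsReducedGroebnerBasis MonomialOrder.lex
        (SkipGroebner.basisJ n k r) (SkipGroebner.idealJ n k r))) :=
  mainTheorem6_general n k r hkn (by omega)
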